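/- Let $p$ be a prime, $F$ a field of characteristic $p$ and $n\ge 0$. Notation. For a composition $q=(q_1,\dots,q_k)$ of $n$ put $q_i^+=q_1+\dots+q_i$ and $\Xi^q=\sum\sigma\in F\mathfrak S_n$, the sum over all $\sigma\in\mathfrak S_n$ whose descent set $\{i\in[1,n-1]:(i)\sigma>(i+1)\sigma\}$ is contained in $\{q_1^+,\dots,q_k^+\}$ (permutations act on the right and are composed from left to right). The descent algebra $\mathrm{Des}_n(F)$ is the $F$-span of the $\Xi^q$; it is a subalgebra of $F\mathfrak S_n$ with basis the $\Xi^q$. Write $r\approx q$ if $r$ is a rearrangement of $q$, write $r\preccurlyeq q$ ($r$ is a weak refinement of $q$) if some rearrangement of $r$ is a concatenation of compositions of $q_1,\dots,q_k$, and $r\prec q$ if $r\preccurlyeq q$ and $r\not\approx q$. A partition is $p$-regular if none of its parts is repeated $p$ or more times; $\Lambda_p^+(n)$ is the set of $p$-regular partitions of $n$. For a partition $\lambda$ let $\lambda¡=\prod_i m_i(\lambda)!$, where $m_i(\lambda)$ is the number of parts of $\lambda$ equal to $i$. For a partition $\mu$ of $n$ let $\varphi^{q,F}(\mu)\in F$ be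 the image in $F$ of the number of $q$-tabloids (right cosets of the Young subgroup $\mathfrak S_q$) fixed by a permutation of cycle type $\mu$. Solomon's epimorphism is the $F$-linear map $c_{n,F}$ with $c_{n,F}(\Xi^q)=\varphi^{q,F}$ from $\mathrm{Des}_n(F)$ onto the $F$-span of the functions $\varphi^{q,F}$. Two partitions of $n$ are $p$-equivalent if permutations with these cycle types have conjugate $p'$-parts; $\mathrm{char}_{\lambda,F}$ is the characteristic function of the $p$-equivalence class of $\lambda$. Construction. Fix a total order $\le$ on the partitions of $n$ such that $\mu\preccurlyeq\lambda$ implies $\mu\le\lambda$, and let $\lambda^{(1)}<\dots<\lambda^{(m)}$ be the $p$-regular partitions of $n$. Let $(b_{\lambda,\mu})$ be the inverse of the matrix $\Phi^F=(\varphi^{\lambda,F}(\mu))_{\lambda,\mu\in\Lambda_p^+(n)}$, and put $f_{\lambda,F}=\sum_{\mu\in\Lambda^+_p(n)}b_{\lambda,\mu}\Xi^\mu$ and $f_{\ge i}=\sum_{j\ge i}f_{\lambda^{(j)},F}$. Let $a^{p^\infty}$ denote the idempotent $a^{p^k}$ for all large $k$. Define $f_1'=1$, $f_i'=(f_{i-1}'f_{\ge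 i}f_{i-1}')^{p^\infty}$ for $2\le i\le m$, $f_{m+1}'=0$, and $e_{\lambda^{(i)},F}=f_i'-f_{i+1}'$ for $1\le i\le m$. Theorem. The elements $e_{\lambda,F}$, $\lambda\in\Lambda_p^+(n)$, form a complete set of orthogonal primitive idempotents of $\mathrm{Des}_n(F)$, with $\sum_{\lambda\in\Lambda^+_p(n)}e_{\lambda,F}=1$ and $c_{n,F}(e_{\lambda,F})=\mathrm{char}_{\lambda,F}$ for every $\lambda\in\Lambda_p^+(n)$. Furthermore $$e_{\lambda,F}=\frac1{\lambda¡}\,\Xi^\lambda+\epsilon_\lambda,$$ where $\epsilon_\lambda$ is an $F$-linear combination of elements $\Xi^\xi$ with $\xi$ a composition of $n$ such that $\xi\prec\lambda$. -/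

import Mathlib

namespace DescentAlg
open Equiv

variable {n : ℕ}

/-- The descent set of `σ`, as a set of 1-based positions: `i ∈ [1, n-1]` is a descent if
`σ(i) > σ(i+1)`; the 1-based position `i` is the element `i - 1` of `Fin n`. -/
def descents (σ : Perm (Fin n)) : Finset ℕ :=
  (Finset.Icc 1 (n - 1)).filter fun i => ∃ h : i < n, σ ⟨i, h⟩ < σ ⟨i - 1, by omega⟩

/-- The partial sums `q₁ + ⋯ + qᵢ` of the composition `q`, for `i ∈ [1, ℓ(q)]`. -/
def partialSums (q : Composition n) : Finset ℕ :=
  (Finset.Icc 1 q.length).image q.sizeUpTo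

/-- The group algebra of the symmetric group. Permutations are multiplied from left to right
(`στ` is first `σ`, then `τ`), which is the opposite of the composition of functions. -/
abbrev SymAlg (F : Type*) [Field F] (n : ℕ) : Type _ :=
  MonoidAlgebra F (Perm (Fin n))ᵐᵒᵖ

/-- Solomon's descent element `Ξ^q`. -/
noncomputable def xi (F : Type*) [Field F] (q : Composition n) : SymAlg F n :=
  ∑ σ : Perm (Fin n) with descents σ ⊆ partialSums q, MonoidAlgebra.single (MulOpposite.op σ) 1

theorem mem_descents_succ {σ : Perm (Fin n)} {i : ℕ} (hi : i + 1 < n) :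
    i + 1 ∈ descents σ ↔ σ ⟨i + 1, hi⟩ < σ ⟨i, by omega⟩ := by
  simp only [descents, Finset.mem_filter, Finset.mem_Icc]
  constructor
  · rintro ⟨_, _, h⟩
    exact h
  · intro h
    exact ⟨by omega, hi, h⟩

theorem descents_subset_iff {σ : Perm (Fin n)} {J : Finset ℕ} :
    descents σ ⊆ J ↔ ∀ (i : ℕ) (hi : i + 1 < n), i + 1 ∉ J → σ ⟨i, by omega⟩ < σ ⟨i + 1, hi⟩ := by
  constructor
  · intro h i hi hJ
    have h1 : ¬ (σ ⟨i + 1, hi⟩ < σ ⟨i, by omega⟩) := fun h2 => hJ (h ((mem_descents_succ hi).2 h2))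
    refine lt_of_le_of_ne (not_lt.1 h1) fun h2 => ?_
    have := σ.injective h2
    simp at this
  · intro h j hj
    obtain ⟨i, rfl⟩ : ∃ i, j = i + 1 := ⟨j - 1, by simp [descents] at hj; omega⟩
    have hi : i + 1 < n := by simp [descents] at hj; omega
    by_contra hJ
    exact absurd ((mem_descents_succ hi).1 hj) (not_lt.2 (h i hi hJ).le)

theorem index_mono (q : Composition n) : Monotone q.index := by
  intro a b hab
  by_contra h
  have h1 := q.lt_sizeUpTo_index_succ b
  have h2 := q.sizeUpTo_index_le a
  have h3 : q.sizeUpTo (q.index b).succ ≤ q.sizeUpTo (q.index a) :=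
    q.monotone_sizeUpTo (by
      have h0 := Fin.lt_def.1 (not_le.1 h)
      rw [Fin.val_succ]
      omega)
  have h4 : (a : ℕ) ≤ b := hab
  omega

theorem mem_partialSums_iff (q : Composition n) {i : ℕ} (hi : i + 1 < n) :
    i + 1 ∈ partialSums q ↔ q.index ⟨i, by omega⟩ ≠ q.index ⟨i + 1, hi⟩ := by
  have a1 : _ ≤ i := q.sizeUpTo_index_le ⟨i, by omega⟩
  have a2 : i < _ := q.lt_sizeUpTo_index_succ ⟨i, by omega⟩
  have b1 : _ ≤ i + 1 := q.sizeUpTo_index_le ⟨i + 1, hi⟩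
  have b2 : i + 1 < _ := q.lt_sizeUpTo_index_succ ⟨i + 1, hi⟩
  simp only [Fin.val_succ] at a2 b2
  constructor
  · intro h he
    simp only [partialSums, Finset.mem_image, Finset.mem_Icc] at h
    obtain ⟨k, hk, hk2⟩ := h
    rw [he] at a1 a2
    have h1 : ¬ k ≤ (q.index ⟨i + 1, hi⟩ : ℕ) := fun h => by
      have := q.monotone_sizeUpTo h
      omega
    have h2 : ¬ (q.index ⟨i + 1, hi⟩ : ℕ) + 1 ≤ k := fun h => by
      have := q.monotone_sizeUpTo h
      omega
    omega
  · intro hne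
    have hle : q.index ⟨i, by omega⟩ ≤ q.index ⟨i + 1, hi⟩ :=
      index_mono q (by simp)
    have hlt : (q.index ⟨i, by omega⟩ : ℕ) + 1 ≤ q.index ⟨i + 1, hi⟩ :=
      Fin.lt_def.1 (lt_of_le_of_ne hle hne)
    have h1 := q.monotone_sizeUpTo hlt
    simp only [partialSums, Finset.mem_image, Finset.mem_Icc]
    exact ⟨q.index ⟨i + 1, hi⟩, ⟨by omega, (q.index ⟨i + 1, hi⟩).2.le⟩, by omega⟩

theorem lt_of_steps {α : Type*} [PartialOrder α] {u : Fin n → α} (hu : Monotone u)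
    {σ : Perm (Fin n)}
    (h : ∀ (i : ℕ) (hi : i + 1 < n), u ⟨i, by omega⟩ = u ⟨i + 1, hi⟩ →
      σ ⟨i, by omega⟩ < σ ⟨i + 1, hi⟩)
    {a b : Fin n} (hab : a < b) (he : u a = u b) : σ a < σ b := by
  obtain ⟨a, ha⟩ := a
  obtain ⟨b, hb⟩ := b
  have hab' : a < b := hab
  induction b, hab' using Nat.le_induction with
  | base => exact h a hb he
  | succ b hle ih =>
    have hb' : b < n := by omega
    have hab2 : (⟨a, ha⟩ : Fin n) < ⟨b, hb'⟩ := hle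
    have h1 : u ⟨a, ha⟩ ≤ u ⟨b, hb'⟩ := hu hab2.le
    have h2 : u ⟨b, hb'⟩ ≤ u ⟨b + 1, hb⟩ := hu (by simp)
    have h3 : u ⟨a, ha⟩ = u ⟨b, hb'⟩ := le_antisymm h1 (he ▸ h2)
    exact (ih hb' hab2 h3).trans (h b hb (h3.symm.trans he))

theorem descents_subset_partialSums_iff {σ : Perm (Fin n)} {q : Composition n} :
    descents σ ⊆ partialSums q ↔ ∀ a b, a < b → q.index a = q.index b → σ a < σ b := by
  rw [descents_subset_iff]
  constructor
  · intro h a b hab he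
    refine lt_of_steps (index_mono q) (fun i hi h1 => h i hi ?_) hab he
    rw [mem_partialSums_iff q hi]
    exact not_not.2 h1
  · intro h i hi hJ
    rw [mem_partialSums_iff q hi, not_not] at hJ
    exact h _ _ (by simp [Fin.lt_def]) hJ

theorem mem_partialSums_iff_boundaries (q : Composition n) {i : ℕ} (hi : i + 1 < n) :
    i + 1 ∈ partialSums q ↔ (⟨i + 1, by omega⟩ : Fin (n + 1)) ∈ q.boundaries := by
  simp only [partialSums, Finset.mem_image, Finset.mem_Icc, Composition.boundaries, Finset.mem_map,
    Finset.mem_univ, true_and, Composition.boundary]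
  constructor
  · rintro ⟨k, hk, h⟩
    exact ⟨⟨k, by omega⟩, Fin.ext h⟩
  · rintro ⟨k, h⟩
    have h' : q.sizeUpTo k = i + 1 := congrArg Fin.val h
    refine ⟨k, ⟨?_, by omega⟩, h'⟩
    by_contra h0
    rw [show (k : ℕ) = 0 by omega, q.sizeUpTo_zero] at h'
    omega

theorem exists_composition (J : Finset ℕ) :
    ∃ q : Composition n, ∀ (i : ℕ), i + 1 < n → (i + 1 ∈ partialSums q ↔ i + 1 ∈ J) := by
  classical
  let c : CompositionAsSet n :=
    { boundaries := Finset.univ.filter fun x : Fin (n + 1) => x = 0 ∨ x = Fin.last n ∨ (x : ℕ) ∈ J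
      zero_mem := by simp
      getLast_mem := by simp }
  refine ⟨c.toComposition, fun i hi => ?_⟩
  rw [mem_partialSums_iff_boundaries _ hi, c.toComposition_boundaries]
  simp only [c, Finset.mem_filter, Finset.mem_univ, true_and]
  constructor
  · rintro (h | h | h)
    · simp [Fin.ext_iff] at h
    · simp [Fin.ext_iff] at h; omega
    · exact h
  · exact fun h => Or.inr (Or.inr h)

theorem composition_ext {q r : Composition n}
    (h : ∀ i, i + 1 < n → (i + 1 ∈ partialSums q ↔ i + 1 ∈ partialSums r)) : q = r := by
  apply (compositionEquiv n).injective
  apply CompositionAsSet.ext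
  change q.boundaries = r.boundaries
  ext ⟨x, hx⟩
  have h0 : ∀ s : Composition n, (0 : Fin (n + 1)) ∈ s.boundaries := fun s =>
    s.toCompositionAsSet.zero_mem
  have hl : ∀ s : Composition n, Fin.last n ∈ s.boundaries := fun s =>
    s.toCompositionAsSet.getLast_mem
  rcases Nat.eq_zero_or_pos x with rfl | hx0
  · exact iff_of_true (h0 q) (h0 r)
  · obtain ⟨i, rfl⟩ : ∃ i, x = i + 1 := ⟨x - 1, by omega⟩
    by_cases hi : i + 1 < n
    · rw [← mem_partialSums_iff_boundaries q hi, ← mem_partialSums_iff_boundaries r hi, h i hi]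
    · have : (⟨i + 1, hx⟩ : Fin (n + 1)) = Fin.last n := Fin.ext (by simp; omega)
      rw [this]
      exact iff_of_true (hl q) (hl r)

theorem descents_subset_congr {σ : Perm (Fin n)} {J K : Finset ℕ}
    (h : ∀ i, i + 1 < n → (i + 1 ∈ J ↔ i + 1 ∈ K)) : descents σ ⊆ J ↔ descents σ ⊆ K := by
  simp only [descents_subset_iff]
  exact forall_congr' fun i => forall_congr' fun hi => by rw [h i hi]

/-- Every set of positions is the descent set of a permutation. -/
theorem exists_descents (J : Finset ℕ) :
    ∃ σ : Perm (Fin n), ∀ i, i + 1 < n → (i + 1 ∈ descents σ ↔ i + 1 ∈ J) := by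
  classical
  let key : Fin n → ℤ := fun a => -((J.filter fun j => j ≤ (a : ℕ)).card : ℤ)
  let s := Tuple.sort key
  have hs : Monotone (key ∘ s) := Tuple.monotone_sort key
  have ht : ∀ i j, i < j → key (s i) = key (s j) → s i < s j :=
    ((Tuple.eq_sort_iff (f := key) (σ := s)).1 rfl).2
  have key1 : ∀ a b, key a < key b → s⁻¹ a < s⁻¹ b := by
    intro a b hab
    by_contra h
    have := hs (not_lt.1 h)
    simp at this
    omega
  have key2 : ∀ a b, a < b → key a = key b → s⁻¹ a < s⁻¹ b := by
    intro a b hab he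
    by_contra h
    rcases lt_or_eq_of_le (not_lt.1 h) with h1 | h1
    · have := ht _ _ h1 (by simp [he])
      simp at this
      exact absurd hab (not_lt.2 this.le)
    · exact hab.ne (s⁻¹.injective h1.symm)
  refine ⟨s⁻¹, fun i hi => ?_⟩
  rw [mem_descents_succ hi]
  by_cases hJ : i + 1 ∈ J
  · refine iff_of_true (key1 _ _ ?_) hJ
    have : (J.filter fun j => j ≤ i) ⊂ (J.filter fun j => j ≤ i + 1) := by
      refine Finset.ssubset_iff_subset_ne.2 ⟨fun j hj => ?_, fun h => ?_⟩
      · simp only [Finset.mem_filter] at hj ⊢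
        exact ⟨hj.1, by omega⟩
      · have : i + 1 ∈ J.filter fun j => j ≤ i := h ▸ by simp [hJ]
        simp at this
    have := Finset.card_lt_card this
    simp only [key]
    omega
  · refine iff_of_false (not_lt.2 (key2 _ _ (by simp [Fin.lt_def]) ?_).le) hJ
    have : (J.filter fun j => j ≤ i) = (J.filter fun j => j ≤ i + 1) := by
      ext j
      simp only [Finset.mem_filter]
      refine and_congr_right fun hj => ⟨fun h => by omega, fun h => ?_⟩
      have : j ≠ i + 1 := fun h => hJ (h ▸ hj)
      omega
    simp only [key, this]

theorem coeff_xi (F : Type*) [Field F] (q : Composition n) (σ : Perm (Fin n)) :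
    (xi F q).coeff (MulOpposite.op σ) = if descents σ ⊆ partialSums q then 1 else 0 := by
  classical
  simp only [xi, MonoidAlgebra.coeff_sum, MonoidAlgebra.coeff_single, Finsupp.finsetSum_apply,
    Finsupp.single_apply, MulOpposite.op_inj]
  rw [Finset.sum_ite_eq']
  simp

theorem linearIndependent_xi (F : Type*) [Field F] (n : ℕ) :
    LinearIndependent F (xi F : Composition n → SymAlg F n) := by
  classical
  rw [Fintype.linearIndependent_iff]
  intro g hg
  have hsum : ∀ σ : Perm (Fin n), ∑ q, (if descents σ ⊆ partialSums q then g q else 0) = 0 := by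
    intro σ
    have h := congrArg (fun x : SymAlg F n => x.coeff (MulOpposite.op σ)) hg
    simpa [MonoidAlgebra.coeff_sum, Finsupp.finsetSum_apply, coeff_xi] using h
  by_contra hne
  push Not at hne
  obtain ⟨q, hq, hmax⟩ := Finset.exists_max_image
    (Finset.univ.filter fun q : Composition n => g q ≠ 0)
    (fun q => ((Finset.Icc 1 (n - 1)).filter fun i => i ∈ partialSums q).card)
    (by obtain ⟨i, hi⟩ := hne; exact ⟨i, by simp [hi]⟩)
  simp only [Finset.mem_filter, Finset.mem_univ, true_and] at hq hmax
  obtain ⟨σ, hσ⟩ := exists_descents (n := n) (partialSums q)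
  have h := hsum σ
  rw [Finset.sum_eq_single q] at h
  · rw [if_pos] at h
    · exact hq h
    · rw [descents_subset_congr (K := descents σ) fun i hi => (hσ i hi).symm]
  · intro r _ hrq
    by_cases hr : g r = 0
    · simp [hr]
    rw [if_neg]
    intro hsub
    apply hrq
    have hss : ((Finset.Icc 1 (n - 1)).filter fun i => i ∈ partialSums q) ⊆
        ((Finset.Icc 1 (n - 1)).filter fun i => i ∈ partialSums r) := by
      intro j hj
      simp only [Finset.mem_filter, Finset.mem_Icc] at hj ⊢
      obtain ⟨i, rfl⟩ : ∃ i, j = i + 1 := ⟨j - 1, by omega⟩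
      exact ⟨hj.1, hsub ((hσ i (by omega)).2 hj.2)⟩
    have heq := Finset.eq_of_subset_of_card_le hss (hmax r hr)
    refine composition_ext fun i hi => ?_
    have := Finset.ext_iff.1 heq (i + 1)
    simp only [Finset.mem_filter, Finset.mem_Icc] at this
    have h1 : 1 ≤ i + 1 ∧ i + 1 ≤ n - 1 := by omega
    tauto
  · simp

theorem one_mem_span (F : Type*) [Field F] (n : ℕ) :
    (1 : SymAlg F n) ∈ Submodule.span F (Set.range (xi F : Composition n → SymAlg F n)) := by
  classical
  obtain ⟨q, hq⟩ := exists_composition (n := n) ∅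
  suffices h : xi F q = 1 from h ▸ Submodule.subset_span ⟨q, rfl⟩
  have : (Finset.univ.filter fun σ : Perm (Fin n) => descents σ ⊆ partialSums q) = {1} := by
    ext σ
    simp only [Finset.mem_filter, Finset.mem_univ, true_and, Finset.mem_singleton]
    rw [descents_subset_congr hq, descents_subset_iff]
    constructor
    · intro h
      have h2 : ∀ a b : Fin n, a < b → σ a < σ b := fun a b hab =>
        lt_of_steps (u := fun _ => (0 : ℕ)) monotone_const
          (fun i hi _ => h i hi (by simp)) hab rfl
      exact (Equiv.Perm.monotone_iff σ).1 (StrictMono.monotone fun a b hab => h2 a b hab)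
    · rintro rfl i hi _
      simp [Fin.lt_def]
  rw [xi, this, Finset.sum_singleton]
  rfl

/-- The span of the descent elements is closed under multiplication. -/
theorem xi_mul_xi_mem (F : Type*) [Field F] (r q : Composition n) :
    xi F r * xi F q ∈ Submodule.span F (Set.range (xi F : Composition n → SymAlg F n)) := by
  classical
  have e1 : xi F r * xi F q = ∑ x : Perm (Fin n) × Perm (Fin n) with
      descents x.1 ⊆ partialSums r ∧ descents x.2 ⊆ partialSums q,
      MonoidAlgebra.single (MulOpposite.op (x.2 * x.1)) (1 : F) := by
    rw [xi, xi, Finset.sum_mul_sum, ← Finset.sum_product']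
    refine Finset.sum_congr ?_ fun x _ => ?_
    · ext x
      simp
    · rw [MonoidAlgebra.single_mul_single, mul_one, ← MulOpposite.op_mul]
  rw [e1, ← Finset.sum_fiberwise_of_maps_to (g := fun x => q.index ∘ x.1)
    (t := Finset.univ) (fun _ _ => Finset.mem_univ _)]
  refine Submodule.sum_mem _ fun u _ => ?_
  rcases Finset.eq_empty_or_nonempty (Finset.filter (fun x => q.index ∘ x.1 = u)
    (Finset.univ.filter fun x : Perm (Fin n) × Perm (Fin n) =>
      descents x.1 ⊆ partialSums r ∧ descents x.2 ⊆ partialSums q)) with h0 | ⟨⟨ρ, ρ'⟩, hρ⟩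
  · rw [h0]
    simp
  simp only [Finset.mem_filter, Finset.mem_univ, true_and] at hρ
  obtain ⟨⟨hρr, -⟩, hρu⟩ := hρ
  rw [descents_subset_partialSums_iff] at hρr
  have hu : ∀ a b, a < b → r.index a = r.index b → u a ≤ u b := by
    intro a b hab he
    rw [← hρu]
    exact index_mono q (hρr a b hab he).le
  let k : Fin n → (Fin r.length ×ₗ Fin q.length) := fun a => toLex (r.index a, u a)
  have hk : ∀ a b, k a = k b ↔ r.index a = r.index b ∧ u a = u b := by
    intro a b
    simp [k]
  have hkm : Monotone k := by
    intro a b hab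
    rcases eq_or_lt_of_le hab with rfl | hab'
    · exact le_rfl
    rw [Prod.Lex.le_iff]
    rcases eq_or_lt_of_le (index_mono r hab) with h | h
    · exact Or.inr ⟨h, hu a b hab' h⟩
    · exact Or.inl h
  obtain ⟨s, hs⟩ := exists_composition (n := n)
    (((Finset.Icc 1 (n - 1)).filter fun j => ∃ i, ∃ hi : i + 1 < n, j = i + 1 ∧
      k ⟨i, by omega⟩ ≠ k ⟨i + 1, hi⟩))
  have hsk : ∀ π : Perm (Fin n), descents π ⊆ partialSums s ↔
      ∀ a b, a < b → k a = k b → π a < π b := by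
    intro π
    rw [descents_subset_iff]
    constructor
    · intro h a b hab he
      refine lt_of_steps hkm (fun i hi h1 => h i hi ?_) hab he
      rw [hs i hi]
      simp only [Finset.mem_filter, not_and]
      rintro _ ⟨i', hi', hii, hne⟩
      obtain rfl : i = i' := by omega
      exact hne h1
    · intro h i hi hJ
      refine h _ _ (by simp [Fin.lt_def]) ?_
      by_contra hne
      refine hJ ((hs i hi).2 ?_)
      simp only [Finset.mem_filter, Finset.mem_Icc]
      exact ⟨by omega, i, hi, rfl, hne⟩
  refine Submodule.subset_span ⟨s, ?_⟩
  rw [xi]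
  symm
  refine Finset.sum_bij (fun x _ => x.2 * x.1) ?_ ?_ ?_ ?_
  · rintro ⟨τ, σ⟩ hx
    simp only [Finset.mem_filter, Finset.mem_univ, true_and] at hx ⊢
    obtain ⟨⟨h1, h2⟩, h3⟩ := hx
    rw [descents_subset_partialSums_iff] at h1 h2
    rw [hsk]
    intro a b hab he
    rw [hk] at he
    refine h2 _ _ (h1 a b hab he.1) ?_
    rw [← h3] at he
    exact he.2
  · rintro ⟨τ, σ⟩ hx ⟨τ', σ'⟩ hx' he
    simp only [Finset.mem_filter, Finset.mem_univ, true_and] at hx hx' he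
    obtain ⟨⟨-, h2⟩, h3⟩ := hx
    obtain ⟨⟨-, h2'⟩, h3'⟩ := hx'
    rw [descents_subset_partialSums_iff] at h2 h2'
    have key : ∀ (τ σ : Perm (Fin n)), q.index ∘ τ = u →
        (∀ a b, a < b → q.index a = q.index b → σ a < σ b) →
        σ = Tuple.sort (u ∘ (σ * τ).symm) := by
      intro τ σ h3 h2
      have hf : ∀ a, (u ∘ (σ * τ).symm) (σ a) = q.index a := by
        intro a
        have h0 : (σ * τ).symm (σ a) = τ.symm a := by
          rw [Equiv.symm_apply_eq]
          simp
        rw [Function.comp_apply, h0, ← h3]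
        simp
      rw [Tuple.eq_sort_iff]
      refine ⟨?_, fun i j hij h => ?_⟩
      · intro a b hab
        simp only [Function.comp_apply] at hf ⊢
        rw [hf, hf]
        exact index_mono q hab
      · rw [hf, hf] at h
        exact h2 i j hij h
    have hσ : σ = σ' := by
      rw [key τ σ h3 h2, key τ' σ' h3' h2', he]
    subst hσ
    rw [mul_left_cancel he]
  · intro π hπ
    simp only [Finset.mem_filter, Finset.mem_univ, true_and] at hπ
    rw [hsk] at hπ
    have hsort := (Tuple.eq_sort_iff (f := u ∘ π.symm) (σ := Tuple.sort (u ∘ π.symm))).1 rfl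
    set σ := Tuple.sort (u ∘ π.symm) with hσ
    have hi : (u ∘ π.symm) ∘ σ = q.index := by
      have h1 : (u ∘ π.symm) ∘ σ = q.index ∘ (ρ * π⁻¹ * σ) := by
        rw [← hρu]
        rfl
      have h2 := Tuple.unique_monotone (f := q.index) (σ := ρ * π⁻¹ * σ) (τ := 1)
        (h1 ▸ hsort.1) (index_mono q)
      rw [h1, h2]
      rfl
    have hi' : ∀ a, q.index (σ⁻¹ (π a)) = u a := by
      intro a
      rw [← hi]
      simp
    have hσd : ∀ a b, a < b → q.index a = q.index b → σ a < σ b := by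
      intro a b hab he
      rw [← hi] at he
      exact hsort.2 a b hab he
    refine ⟨(σ⁻¹ * π, σ), ?_, by simp⟩
    simp only [Finset.mem_filter, Finset.mem_univ, true_and]
    refine ⟨⟨?_, descents_subset_partialSums_iff.2 hσd⟩, funext hi'⟩
    rw [descents_subset_partialSums_iff]
    intro a b hab he
    rcases eq_or_lt_of_le (hu a b hab he) with h | h
    · have h1 := hπ a b hab ((hk a b).2 ⟨he, h⟩)
      by_contra h2
      rcases eq_or_lt_of_le (not_lt.1 h2) with h3 | h3
      · exact hab.ne ((σ⁻¹ * π).injective h3.symm)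
      · have h4 := hσd _ _ h3 ((hi' b).trans (h.symm.trans (hi' a).symm))
        simp at h4
        exact absurd h1 (not_lt.2 h4.le)
    · by_contra h2
      have := index_mono q (not_lt.1 h2)
      simp only [Perm.coe_mul, Function.comp_apply, hi'] at this
      exact absurd h (not_lt.2 this)
  · intro x _
    rfl

/-- The descent algebra: the linear span of the `Ξ^q`, a subalgebra of the group algebra. -/
noncomputable def descentAlgebra (F : Type*) [Field F] (n : ℕ) : Subalgebra F (SymAlg F n) :=
  (Submodule.span F (Set.range (xi F : Composition n → SymAlg F n))).toSubalgebra
    (one_mem_span F n) (by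
      intro x y hx hy
      have h : ∀ z ∈ Submodule.span F (Set.range (xi F : Composition n → SymAlg F n)) *
          Submodule.span F (Set.range (xi F : Composition n → SymAlg F n)),
          z ∈ Submodule.span F (Set.range (xi F : Composition n → SymAlg F n)) := by
        rw [Submodule.span_mul_span]
        refine fun z hz => Submodule.span_le.2 ?_ hz
        rintro _ ⟨_, ⟨r, rfl⟩, _, ⟨q, rfl⟩, rfl⟩
        exact xi_mul_xi_mem F r q
      exact h _ (Submodule.mul_mem_mul hx hy))

/-- `Ξ^q` as an element of the descent algebra. -/
noncomputable def xiD (F : Type*) [Field F] (q : Composition n) : descentAlgebra F n :=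
  ⟨xi F q, Submodule.subset_span ⟨q, rfl⟩⟩

/-- The basis of the descent algebra that consists of the `Ξ^q`. -/
noncomputable def xiBasis (F : Type*) [Field F] (n : ℕ) :
    Module.Basis (Composition n) F (descentAlgebra F n) :=
  Module.Basis.mk (v := fun q => xiD F q)
    (LinearIndependent.of_comp (descentAlgebra F n).val.toLinearMap (linearIndependent_xi F n))
    (by
      rintro ⟨x, hx⟩ -
      have hx' : x ∈ Submodule.span F (Set.range (xi F : Composition n → SymAlg F n)) := hx
      induction hx' using Submodule.span_induction with
      | mem x h =>
        obtain ⟨q, rfl⟩ := h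
        exact Submodule.subset_span ⟨q, rfl⟩
      | zero => exact Submodule.zero_mem _
      | add x y h1 h2 i1 i2 => exact Submodule.add_mem _ (i1 h1) (i2 h2)
      | smul a x h1 i1 => exact Submodule.smul_mem _ a (i1 h1))

theorem xiBasis_apply (F : Type*) [Field F] (q : Composition n) : xiBasis F n q = xiD F q := by
  simp [xiBasis]

/-- `r ≤ q`: the composition `r` is a (strong) refinement of `q`, that is, `r` is a concatenation of
compositions of the parts of `q`. -/
def Refines (r q : Composition n) : Prop :=
  ∃ L : List (List ℕ), r.blocks = L.flatten ∧ q.blocks = L.map List.sum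

/-- `r ≼ q`: the composition `r` is a weak refinement of `q`, that is, some rearrangement of `r` is
a refinement of `q`. -/
def WeakRefines (r q : Composition n) : Prop :=
  ∃ s : Composition n, r.blocks.Perm s.blocks ∧ Refines s q

/-- `r ≺ q`: `r` is a weak refinement of `q` but not a rearrangement of `q`. -/
def ProperWeakRefines (r q : Composition n) : Prop :=
  WeakRefines r q ∧ ¬ r.blocks.Perm q.blocks

/-- A partition, viewed as the composition with the same parts in weakly decreasing order. -/
def toComp (lam : n.Partition) : Composition n where
  blocks := lam.parts.sort (· ≥ ·)
  blocks_pos h := lam.parts_pos ((Multiset.mem_sort _).1 h)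
  blocks_sum := by rw [← Multiset.sum_coe, Multiset.sort_eq, lam.parts_sum]

/-- `p`-regular partitions of `n`: no part is repeated `p` or more times. -/
abbrev RegPartition (n p : ℕ) : Type :=
  {lam : n.Partition // ∀ i ∈ lam.parts, lam.parts.count i < p}

/-- `λ¡ = ∏ᵢ mᵢ(λ)!`, where `mᵢ(λ)` is the number of parts of `λ` equal to `i`. -/
def multFactorial (lam : n.Partition) : ℕ :=
  ∏ i ∈ lam.parts.toFinset, (lam.parts.count i).factorial

/-- The permutation `σ` has cycle type `μ`, fixed points being cycles of length `1`. -/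
def HasType (σ : Perm (Fin n)) (μ : n.Partition) : Prop :=
  σ.partition.parts = μ.parts

theorem exists_hasType (μ : n.Partition) : ∃ σ : Perm (Fin n), HasType σ μ := by
  classical
  obtain ⟨σ, hσ⟩ := (Equiv.Perm.exists_with_cycleType_iff (Fin n)
    (m := μ.parts.filter fun i => 2 ≤ i)).2 ⟨by
      rw [Fintype.card_fin]
      conv_rhs => rw [← μ.parts_sum, ← Multiset.filter_add_not (fun i => 2 ≤ i) μ.parts,
        Multiset.sum_add]
      exact Nat.le_add_right _ _, by
      intro a ha
      exact (Multiset.mem_filter.1 ha).2⟩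
  refine ⟨σ, ?_⟩
  have h := Equiv.Perm.sum_cycleType σ
  have h1 : μ.parts.filter (fun i => ¬ 2 ≤ i) =
      Multiset.replicate (Multiset.card (μ.parts.filter fun i => ¬ 2 ≤ i)) 1 := by
    rw [Multiset.eq_replicate_card]
    intro b hb
    have h2 := Multiset.mem_filter.1 hb
    have h3 := μ.parts_pos h2.1
    omega
  have h2 := Multiset.filter_add_not (fun i => 2 ≤ i) μ.parts
  have h3 := congrArg Multiset.sum h2
  rw [Multiset.sum_add, μ.parts_sum, ← hσ, h, h1] at h3
  simp only [Multiset.sum_replicate, smul_eq_mul, mul_one] at h3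
  rw [HasType, Equiv.Perm.parts_partition, Fintype.card_fin, hσ]
  conv_rhs => rw [← h2, h1]
  congr 2
  omega

/-- The number of `q`-tabloids (equivalently, of right cosets of the Young subgroup of `q`) that are
fixed by `σ`. A `q`-tabloid is given by the map that sends each number to the row it lies in. -/
def numFixedTabloids (q : Composition n) (σ : Perm (Fin n)) : ℕ :=
  Fintype.card {t : Fin n → Fin q.length //
    (∀ j, (Finset.univ.filter fun x => t x = j).card = q.blocksFun j) ∧ ∀ x, t (σ x) = t x}

/-- The `F`-valued Young character `φ^{q,F}`, a function on the set of partitions of `n`. -/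
noncomputable def youngChar (F : Type*) [Field F] (q : Composition n) (μ : n.Partition) : F :=
  (numFixedTabloids q (exists_hasType μ).choose : F)

/-- The space `C_n(F)`: the linear span of the `F`-valued Young characters. -/
noncomputable def youngSpan (F : Type*) [Field F] (n : ℕ) : Submodule F (n.Partition → F) :=
  Submodule.span F (Set.range (youngChar F : Composition n → n.Partition → F))

/-- Solomon's epimorphism: the linear map that sends `Ξ^q` to the Young character `φ^{q,F}`. -/
noncomputable def solomonEpi (F : Type*) [Field F] (n : ℕ) :
    descentAlgebra F n →ₗ[F] youngSpan F n :=
  (xiBasis F n).constr F fun q => ⟨youngChar F q, Submodule.subset_span ⟨q, rfl⟩⟩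

/-- `τ` is the `p'`-part of the permutation `σ`. -/
def IsPPrimePart (p : ℕ) (σ τ : Perm (Fin n)) : Prop :=
  ∃ u : Perm (Fin n), σ = u * τ ∧ Commute u τ ∧ (∃ k, orderOf u = p ^ k) ∧
    (orderOf τ).Coprime p

/-- `p`-equivalence of partitions: permutations with these cycle types have conjugate
`p'`-parts. -/
def PEquiv (p : ℕ) (lam μ : n.Partition) : Prop :=
  ∀ σ τ σ' τ' : Perm (Fin n), HasType σ lam → HasType τ μ →
    IsPPrimePart p σ σ' → IsPPrimePart p τ τ' → IsConj σ' τ'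

/-- The characteristic function of the `p`-equivalence class of `λ`. -/
noncomputable def charFn (p : ℕ) (F : Type*) [Field F] (lam : n.Partition) : n.Partition → F :=
  Set.indicator {μ | PEquiv p μ lam} 1

/-- The matrix `Φ^F = (φ^{λ,F}(μ))`, with rows and columns labelled by the `p`-regular
partitions. -/
noncomputable def youngMatrix (p : ℕ) (F : Type*) [Field F] (n : ℕ) :
    Matrix (RegPartition n p) (RegPartition n p) F :=
  Matrix.of fun lam μ => youngChar F (toComp lam.1) μ.1

/-- `f_{λ,F} = ∑_μ b_{λ,μ} Ξ^μ`, where `(b_{λ,μ})` is the inverse of the matrix `Φ^F`. -/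
noncomputable def fElt (p : ℕ) (F : Type*) [Field F] (lam : RegPartition n p) :
    descentAlgebra F n :=
  ∑ μ : RegPartition n p, (youngMatrix p F n)⁻¹ lam μ • xiD F (toComp μ.1)

open Classical in
/-- `a^{p^∞}`: the idempotent `a^(p^k)`, for all large enough `k`. If `a^(p^k)` is idempotent for
one `k`, then it is the same element for all larger exponents, so that the least `k` will do. -/
noncomputable def powPInf (p : ℕ) {A : Type*} [Ring A] (a : A) : A :=
  if h : ∃ k : ℕ, IsIdempotentElem (a ^ p ^ k) then a ^ p ^ Nat.find h else 0

/-- The number of `p`-regular partitions that are smaller than `λ` in the total order `ord`. -/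
noncomputable def rank {p : ℕ} (ord : LinearOrder n.Partition) (lam : RegPartition n p) : ℕ :=
  Nat.card {μ : RegPartition n p // ord.lt μ.1 lam.1}

/-- The sum of the `f_{λ,F}` over all `p`-regular `λ` that have at least `i` smaller `p`-regular
partitions. -/
noncomputable def fGe (p : ℕ) (F : Type*) [Field F] (ord : LinearOrder n.Partition) (i : ℕ) :
    descentAlgebra F n :=
  ∑ lam : RegPartition n p with i ≤ rank ord lam, fElt p F lam

/-- The elements `f'`, counted from `0`: `f'_0 = 1` and `f'_i = (f'_{i-1} f_{≥ i} f'_{i-1})^{p^∞}`.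
If `i` is the number of all `p`-regular partitions, then `f_{≥ i} = 0` and so `f'_i = 0`. -/
noncomputable def fPrime (p : ℕ) (F : Type*) [Field F] (ord : LinearOrder n.Partition) :
    ℕ → descentAlgebra F n
  | 0 => 1
  | i + 1 => powPInf p (fPrime p F ord i * fGe p F ord (i + 1) * fPrime p F ord i)

/-- The element `e_{λ,F} = f'_i - f'_{i+1}`, where `i` is the position of `λ` (counted from `0`) among
the `p`-regular partitions. -/
noncomputable def eElt (p : ℕ) (F : Type*) [Field F] (ord : LinearOrder n.Partition)
    (lam : RegPartition n p) : descentAlgebra F n :=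
  fPrime p F ord (rank ord lam) - fPrime p F ord (rank ord lam + 1)

/-- Primitive idempotents: nonzero idempotents that are not a sum of two nonzero orthogonal
idempotents. -/
def IsPrimitiveIdempotent {A : Type*} [Ring A] (e : A) : Prop :=
  IsIdempotentElem e ∧ e ≠ 0 ∧ ∀ a b : A, IsIdempotentElem a → IsIdempotentElem b →
    a * b = 0 → b * a = 0 → e = a + b → a = 0 ∨ b = 0

end DescentAlg

open DescentAlg

/-!
The descent algebra acts on itself from the right, and this action is triangular. By the Mackey type
rule for `Ξ^r Ξ^q` (a sum over the matrices of natural numbers with row sums `r` and column sums `q`,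
`xi_mul_xi`), every term other than `Ξ^r` belongs to a proper refinement of `r`, and the coefficient of
`Ξ^r` counts the ways to distribute the parts of `r` over the parts of `q`. That number is the number
of `q`-tabloids fixed by a permutation of cycle type `r`, so that `Ξ^r x` equals `c(x)(r) Ξ^r` plus
terms for finer compositions, where `c` is Solomon's epimorphism (`xiD_mul`). Hence `c` is
multiplicative and its kernel is nil. The same rule shows that the `Ξ^ξ` with `ξ ≼ q`, and also those
with `ξ ≺ q`, span two-sided ideals.

In characteristic `p` the functions in the image of `c` are constant on `p`-equivalence classes, since
a `p`-element has as many fixed points, modulo `p`, as there are points. Each class contains a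
`p`-regular partition, obtained by merging `p` equal parts as long as there are any. The matrix `Φ^F`
is triangular with diagonal entries `λ¡ ≠ 0`; this makes the `p`-regular representative unique, gives
`c(f_λ) = char_λ` and `∑ f_λ = 1`, and shows that `f_λ` is `Ξ^λ/λ¡` plus terms for `ξ ≺ λ`.

An element that is idempotent modulo a nil ideal has idempotent `p^k`-th powers for large `k`. So the
`f'_i` form a decreasing chain of idempotents, `c(f'_i)` being the indicator function of the classes
of rank at least `i`, and their differences `e_λ` are orthogonal idempotents over the functions
`char_λ`. They are primitive because `c` has nil kernel and `char_λ` is a primitive idempotent among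
the functions that are constant on `p`-equivalence classes.

For the leading terms (`eElt_sub_mem`), modulo the ideal of the `ξ ≺ λ`, where `λ` has rank `i`, the
element `φ = Ξ^λ/λ¡` is an idempotent that is fixed from both sides by `a = f'_i f_{≥ i} f'_i`, and
`f'_i f_{≥ i + 1} f'_i ≡ a - φ`. The large `p`-powers of `a` equal `f'_i` and those of `a - φ` are
congruent to `f'_{i + 1}`, so `e_λ ≡ φ`.
-/

namespace DescentAlg
open Equiv

variable {n : ℕ}

/-! ### Compositions and weak refinement -/

theorem card_index_eq (q : Composition n) (j : Fin q.length) :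
    (Finset.univ.filter fun a => q.index a = j).card = q.blocksFun j := by
  have h : (Finset.univ.filter fun a => q.index a = j) =
      Finset.univ.map (q.embedding j).toEmbedding := by
    ext a
    simp only [Finset.mem_filter, Finset.mem_univ, true_and, Finset.mem_map]
    constructor
    · rintro rfl
      exact ⟨_, q.embedding_comp_inv a⟩
    · rintro ⟨i, rfl⟩
      exact q.index_embedding j i
  rw [h, Finset.card_map, Finset.card_univ, Fintype.card_fin]

theorem perm_flatMap_filter {α : Type*} [DecidableEq α] {m : ℕ} (t : α → Fin m) (l : List α) :
    l.Perm ((List.finRange m).flatMap fun j => l.filter fun a => t a = j) := by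
  rw [List.perm_iff_count]
  intro a
  rw [List.count_flatMap, ← List.ofFn_eq_map, List.sum_ofFn]
  rw [Finset.sum_eq_single (t a)]
  · simp [List.count_filter]
  · intro j _ hj
    simp only [Function.comp_apply, List.count_eq_zero, List.mem_filter, decide_eq_true_eq, not_and]
    exact fun _ h => hj h.symm
  · simp

theorem weakRefines_of_map {s q : Composition n} (t : Fin s.length → Fin q.length)
    (h : ∀ j, ∑ i with t i = j, s.blocksFun i = q.blocksFun j) : WeakRefines s q := by
  classical
  have hp : s.blocks.Perm ((List.finRange q.length).map fun j =>
      ((List.finRange s.length).filter fun i => t i = j).map s.blocksFun).flatten := by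
    have h1 := (perm_flatMap_filter t (List.finRange s.length)).map s.blocksFun
    rw [← List.ofFn_eq_map, s.ofFn_blocksFun, List.map_flatMap, List.flatMap_def] at h1
    exact h1
  refine ⟨⟨_, fun {i} hi => s.blocks_pos (hp.mem_iff.2 hi), by rw [← hp.sum_eq, s.blocks_sum]⟩,
    hp, _, rfl, ?_⟩
  rw [List.map_map, ← List.ofFn_eq_map, ← q.ofFn_blocksFun]
  congr 1
  funext j
  rw [← h j, Function.comp_apply, Finset.sum]
  rfl

theorem weakRefines_refl (q : Composition n) : WeakRefines q q :=
  weakRefines_of_map id fun j => by simp [Finset.sum_filter]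

theorem exists_perm_map_eq {α β : Type*} {f : α → β} {l : List α} {m : List β}
    (h : (l.map f).Perm m) : ∃ l', l.Perm l' ∧ l'.map f = m := by
  induction m generalizing l with
  | nil => exact ⟨[], by simpa using h, rfl⟩
  | cons b m ih =>
    obtain ⟨a, ha, rfl⟩ := List.mem_map.1 (h.mem_iff.2 List.mem_cons_self)
    obtain ⟨l₁, l₂, rfl⟩ := List.append_of_mem ha
    have h1 := (List.perm_middle.map f).symm.trans h
    rw [List.map_cons] at h1
    obtain ⟨l', h2, h3⟩ := ih h1.cons_inv
    exact ⟨a :: l', List.perm_middle.trans (h2.cons a), by rw [List.map_cons, h3]⟩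

theorem exists_flatten_eq_of_map_eq {α β : Type*} {f : α → β} {l : List α} {M : List (List β)}
    (h : l.map f = M.flatten) : ∃ N : List (List α), l = N.flatten ∧ M = N.map (List.map f) := by
  induction M generalizing l with
  | nil => exact ⟨[], by simpa using h, rfl⟩
  | cons m M ih =>
    rw [List.flatten_cons, List.map_eq_append_iff] at h
    obtain ⟨l₁, l₂, rfl, rfl, h⟩ := h
    obtain ⟨N, rfl, rfl⟩ := ih h
    exact ⟨l₁ :: N, rfl, rfl⟩

theorem WeakRefines.of_perm {r s q : Composition n} (h : WeakRefines s q)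
    (hp : r.blocks.Perm s.blocks) : WeakRefines r q := by
  obtain ⟨s', h1, h2⟩ := h
  exact ⟨s', hp.trans h1, h2⟩

theorem WeakRefines.trans {s r q : Composition n} (h1 : WeakRefines s r) (h2 : WeakRefines r q) :
    WeakRefines s q := by
  obtain ⟨s', hs, L, hL, hr⟩ := h1
  obtain ⟨r', hr', M, hM, hq⟩ := h2
  rw [hr, hM] at hr'
  obtain ⟨L', hL', hL2⟩ := exists_perm_map_eq hr'
  obtain ⟨N, rfl, rfl⟩ := exists_flatten_eq_of_map_eq hL2
  have hp : s.blocks.Perm (N.map List.flatten).flatten := by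
    rw [← List.flatten_flatten]
    exact hs.trans (hL ▸ hL'.flatten)
  refine ⟨⟨_, fun {i} hi => s.blocks_pos (hp.mem_iff.2 hi), by rw [← hp.sum_eq, s.blocks_sum]⟩,
    hp, _, rfl, ?_⟩
  rw [hq, List.map_map, List.map_map]
  congr 1
  funext K
  simp [List.sum_flatten]

theorem WeakRefines.length_le {s q : Composition n} (h : WeakRefines s q) :
    q.length ≤ s.length := by
  obtain ⟨s', hs, L, hL, hq⟩ := h
  rw [← s.blocks_length, hs.length_eq, hL, ← q.blocks_length, hq, List.length_map,
    List.length_flatten]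
  have h1 := List.card_nsmul_le_sum (L.map List.length) 1 fun x hx => by
    obtain ⟨l, hl, rfl⟩ := List.mem_map.1 hx
    have h2 := q.blocks_pos (hq ▸ List.mem_map_of_mem hl)
    refine List.length_pos_iff.2 fun h => ?_
    rw [h] at h2
    exact lt_irrefl _ h2
  simpa using h1

theorem flatten_eq_map_sum {L : List (List ℕ)} (h0 : ∀ l ∈ L, l ≠ [])
    (h : L.flatten.length ≤ L.length) : L.flatten = L.map List.sum := by
  induction L with
  | nil => rfl
  | cons l L ih =>
    have h1 : L.length ≤ L.flatten.length := by
      have := List.card_nsmul_le_sum (L.map List.length) 1 fun x hx => by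
        obtain ⟨l', hl, rfl⟩ := List.mem_map.1 hx
        exact List.length_pos_iff.2 (h0 l' (List.mem_cons_of_mem _ hl))
      rw [List.length_flatten]
      simpa using this
    have h2 := List.length_pos_iff.2 (h0 l List.mem_cons_self)
    rw [List.flatten_cons, List.length_append, List.length_cons] at h
    obtain ⟨a, rfl⟩ := List.length_eq_one_iff.1 (show l.length = 1 by omega)
    rw [List.flatten_cons, List.map_cons,
      ih (fun l' hl => h0 l' (List.mem_cons_of_mem _ hl)) (by omega)]
    simp

theorem properWeakRefines_iff {s q : Composition n} :
    ProperWeakRefines s q ↔ WeakRefines s q ∧ q.length < s.length := by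
  constructor
  · rintro ⟨h, hne⟩
    refine ⟨h, lt_of_le_of_ne h.length_le fun he => hne ?_⟩
    obtain ⟨s', hs, L, hL, hq⟩ := h
    rw [hq, ← flatten_eq_map_sum (L := L), ← hL]
    · exact hs
    · intro l hl h
      have h2 := q.blocks_pos (hq ▸ List.mem_map_of_mem hl)
      rw [h] at h2
      exact lt_irrefl _ h2
    · rw [← hL, ← hs.length_eq, s.blocks_length, ← he, ← q.blocks_length, hq, List.length_map]
  · rintro ⟨h, hlt⟩
    refine ⟨h, fun hp => ?_⟩
    have := hp.length_eq
    rw [s.blocks_length, q.blocks_length] at this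
    omega

theorem ProperWeakRefines.of_weakRefines {s r q : Composition n} (h : WeakRefines s r)
    (hr : ProperWeakRefines r q) : ProperWeakRefines s q := by
  rw [properWeakRefines_iff] at hr ⊢
  exact ⟨h.trans hr.1, hr.2.trans_le h.length_le⟩

theorem sum_blocksFun_of_index {s : Composition n} {m : ℕ} (t : Fin s.length → Fin m) (j : Fin m) :
    ∑ i with t i = j, s.blocksFun i = (Finset.univ.filter fun a => t (s.index a) = j).card := by
  classical
  rw [Finset.card_eq_sum_card_fiberwise (f := s.index) (t := Finset.univ.filter fun i => t i = j)
    (by intro a ha; simpa using ha)]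
  refine Finset.sum_congr rfl fun i hi => ?_
  rw [← card_index_eq, Finset.filter_filter]
  congr 1
  ext a
  simp only [Finset.mem_filter, Finset.mem_univ, true_and] at hi ⊢
  constructor
  · rintro rfl
    exact ⟨hi, rfl⟩
  · exact fun h => h.2

theorem index_surjective (s : Composition n) : Function.Surjective s.index := fun i =>
  ⟨s.embedding i ⟨0, s.one_le_blocksFun i⟩, s.index_embedding i _⟩

theorem exists_comp_index {s : Composition n} {β : Type*} {v : Fin n → β}
    (h : ∀ a b, s.index a = s.index b → v a = v b) :
    ∃ t : Fin s.length → β, ∀ a, t (s.index a) = v a :=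
  ⟨fun i => v (Function.surjInv (index_surjective s) i), fun _ =>
    h _ _ (Function.surjInv_eq (index_surjective s) _)⟩

theorem weakRefines_of_index {s q : Composition n} (v : Fin n → Fin q.length)
    (hv : ∀ j, (Finset.univ.filter fun a => v a = j).card = q.blocksFun j)
    (h : ∀ a b, s.index a = s.index b → v a = v b) : WeakRefines s q := by
  obtain ⟨t, ht⟩ := exists_comp_index h
  refine weakRefines_of_map t fun j => ?_
  rw [sum_blocksFun_of_index, ← hv]
  simp only [ht]

theorem length_lt_of_index {s r : Composition n}
    (h : ∀ a b, s.index a = s.index b → r.index a = r.index b)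
    (hne : ∃ a b, r.index a = r.index b ∧ s.index a ≠ s.index b) : r.length < s.length := by
  obtain ⟨t, ht⟩ := exists_comp_index h
  have hs : Function.Surjective t := fun j => by
    obtain ⟨a, rfl⟩ := index_surjective r j
    exact ⟨_, ht a⟩
  have hle := Fintype.card_le_of_surjective t hs
  simp only [Fintype.card_fin] at hle
  refine lt_of_le_of_ne hle fun he => ?_
  have hi := ((Fintype.bijective_iff_surjective_and_card t).2 ⟨hs, by simp [he]⟩).1
  obtain ⟨a, b, h1, h2⟩ := hne
  exact h2 (hi (by rw [ht, ht, h1]))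

theorem eq_of_index_iff {s r : Composition n}
    (h : ∀ a b, s.index a = s.index b ↔ r.index a = r.index b) : s = r :=
  composition_ext fun i hi => by
    rw [mem_partialSums_iff _ hi, mem_partialSums_iff _ hi, not_iff_not]
    exact h _ _

/-! ### The multiplication rule for the elements `Ξ^q` -/

theorem eq_of_steps {α β : Type*} [PartialOrder α] {f : Fin n → α} {g : Fin n → β} (hf : Monotone f)
    (h : ∀ (i : ℕ) (hi : i + 1 < n), f ⟨i, by omega⟩ = f ⟨i + 1, hi⟩ →
      g ⟨i, by omega⟩ = g ⟨i + 1, hi⟩) {a b : Fin n} (he : f a = f b) : g a = g b := by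
  have key : ∀ (b a : ℕ) (hb : b < n) (hab : a ≤ b), f ⟨a, by omega⟩ = f ⟨b, hb⟩ →
      g ⟨a, by omega⟩ = g ⟨b, hb⟩ := by
    intro b a hb hab
    induction b, hab using Nat.le_induction with
    | base => exact fun _ => rfl
    | succ b hab ih =>
      intro he
      have h1 : f ⟨a, by omega⟩ ≤ f ⟨b, by omega⟩ := hf hab
      have h2 : f ⟨b, by omega⟩ ≤ f ⟨b + 1, hb⟩ := hf (by simp)
      have h3 : f ⟨a, by omega⟩ = f ⟨b, by omega⟩ := le_antisymm h1 (he ▸ h2)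
      exact (ih (by omega) h3).trans (h b hb (h3.symm.trans he))
  rcases le_total a b with hab | hab
  · exact key b a b.2 hab he
  · exact (key a b a.2 hab he.symm).symm

/-- The level sets of a monotone map on `Fin n` are the blocks of a composition of `n`. -/
theorem exists_composition_index {α : Type*} [PartialOrder α] {k : Fin n → α} (hk : Monotone k) :
    ∃ s : Composition n, ∀ a b, s.index a = s.index b ↔ k a = k b := by
  classical
  obtain ⟨s, hs⟩ := exists_composition (n := n) ((Finset.range n).filter fun j =>
    ∃ i, ∃ hi : i + 1 < n, j = i + 1 ∧ k ⟨i, by omega⟩ ≠ k ⟨i + 1, hi⟩)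
  have key : ∀ (i : ℕ) (hi : i + 1 < n), s.index ⟨i, by omega⟩ = s.index ⟨i + 1, hi⟩ ↔
      k ⟨i, by omega⟩ = k ⟨i + 1, hi⟩ := by
    intro i hi
    rw [← not_iff_not, ← ne_eq, ← mem_partialSums_iff s hi, hs i hi, Finset.mem_filter]
    constructor
    · rintro ⟨_, i', hi', hii, hne⟩
      obtain rfl : i = i' := by omega
      exact hne
    · exact fun h => ⟨Finset.mem_range.2 hi, i, hi, rfl, h⟩
  exact ⟨s, fun a b => ⟨eq_of_steps (index_mono s) fun i hi => (key i hi).1,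
    eq_of_steps hk fun i hi => (key i hi).2⟩⟩

theorem exists_perm_comp_eq {α β : Type*} [Fintype α] [DecidableEq β] {f g : α → β}
    (h : ∀ j, (Finset.univ.filter fun a => f a = j).card =
      (Finset.univ.filter fun a => g a = j).card) : ∃ ρ : Perm α, g ∘ ρ = f := by
  have e : ∀ j, Nonempty ({a // f a = j} ≃ {a // g a = j}) := fun j =>
    Fintype.card_eq.1 (by rw [Fintype.card_subtype, Fintype.card_subtype, h])
  refine ⟨(Equiv.sigmaFiberEquiv f).symm.trans
    ((Equiv.sigmaCongrRight fun j => (e j).some).trans (Equiv.sigmaFiberEquiv g)), ?_⟩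
  funext a
  exact ((e (f a)).some ⟨a, rfl⟩).2

/-- The maps `u : [n] → {columns}` that record, for a permutation `τ` occurring in `Ξ^r`, in which
block of `q` each `τ(a)` lies. They correspond to the matrices of natural numbers with row sums `r`
and column sums `q`: the entry in row `i` and column `j` counts the elements of the `i`-th block of
`r` that are sent to `j`. -/
def IsShuffle (r q : Composition n) (u : Fin n → Fin q.length) : Prop :=
  (∀ a b, a < b → r.index a = r.index b → u a ≤ u b) ∧
    ∀ j, (Finset.univ.filter fun a => u a = j).card = q.blocksFun j

theorem IsShuffle.of_descents {r q : Composition n} {τ : Perm (Fin n)}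
    (h : descents τ ⊆ partialSums r) : IsShuffle r q (q.index ∘ τ) := by
  refine ⟨fun a b hab he => index_mono q (descents_subset_partialSums_iff.1 h a b hab he).le,
    fun j => ?_⟩
  rw [← card_index_eq]
  exact Finset.card_bij (fun a _ => τ a) (by simp) (fun _ _ _ _ h => τ.injective h) fun b hb =>
    ⟨τ⁻¹ b, by simpa using hb, by simp⟩

theorem exists_isShuffle_composition {r q : Composition n} {u : Fin n → Fin q.length}
    (hu : IsShuffle r q u) :
    ∃ s : Composition n, ∀ a b, s.index a = s.index b ↔ r.index a = r.index b ∧ u a = u b := by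
  let k : Fin n → (Fin r.length ×ₗ Fin q.length) := fun a => toLex (r.index a, u a)
  have hkm : Monotone k := by
    intro a b hab
    rcases eq_or_lt_of_le hab with rfl | hab'
    · exact le_rfl
    rw [Prod.Lex.le_iff]
    rcases eq_or_lt_of_le (index_mono r hab) with h | h
    · exact Or.inr ⟨h, hu.1 a b hab' h⟩
    · exact Or.inl h
  obtain ⟨s, hs⟩ := exists_composition_index hkm
  exact ⟨s, fun a b => by rw [hs]; simp [k]⟩

/-- The composition obtained by reading, row by row, the nonzero entries of the matrix that
corresponds to `u`. -/
noncomputable def shuffleComp {r q : Composition n} {u : Fin n → Fin q.length}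
    (hu : IsShuffle r q u) : Composition n :=
  (exists_isShuffle_composition hu).choose

theorem shuffleComp_index {r q : Composition n} {u : Fin n → Fin q.length}
    (hu : IsShuffle r q u) (a b : Fin n) : (shuffleComp hu).index a = (shuffleComp hu).index b ↔
      r.index a = r.index b ∧ u a = u b :=
  (exists_isShuffle_composition hu).choose_spec a b

theorem comp_sort_eq_index {q : Composition n} {v : Fin n → Fin q.length}
    (hv : ∀ j, (Finset.univ.filter fun a => v a = j).card = q.blocksFun j) :
    v ∘ Tuple.sort v = q.index := by
  obtain ⟨ρ, rfl⟩ := exists_perm_comp_eq (f := v) (g := q.index) fun j => by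
    rw [hv, card_index_eq]
  exact Tuple.unique_monotone (f := q.index) (σ := ρ * Tuple.sort (q.index ∘ ρ)) (τ := 1)
    (Tuple.monotone_sort (q.index ∘ ρ)) (index_mono q)

/-- The products of a permutation `τ` from `Ξ^r` with a permutation `σ` from `Ξ^q`, where `τ` has
the pattern `u`, are the permutations from `Ξ^s` for the composition `s` read off from `u`: the
factor `σ` is recovered from `π = στ` by sorting `u ∘ π⁻¹`. -/
theorem sum_shuffle_eq_xi (F : Type*) [Field F] {r q : Composition n} {u : Fin n → Fin q.length}
    (hu : IsShuffle r q u) :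
    ∑ x : Perm (Fin n) × Perm (Fin n) with
      (descents x.1 ⊆ partialSums r ∧ descents x.2 ⊆ partialSums q) ∧ q.index ∘ x.1 = u,
      MonoidAlgebra.single (MulOpposite.op (x.2 * x.1)) (1 : F) = xi F (shuffleComp hu) := by
  classical
  have hv : ∀ (π : Perm (Fin n)) (j : Fin q.length),
      (Finset.univ.filter fun a => (u ∘ π.symm) a = j).card = q.blocksFun j := by
    intro π j
    rw [← hu.2 j]
    exact Finset.card_bij (fun a _ => π.symm a) (by simp) (fun _ _ _ _ h => π.symm.injective h)
      fun b hb => ⟨π b, by simpa using hb, by simp⟩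
  rw [xi]
  refine Finset.sum_nbij' (fun x => x.2 * x.1)
    (fun π => ((Tuple.sort (u ∘ π.symm))⁻¹ * π, Tuple.sort (u ∘ π.symm))) ?_ ?_ ?_ ?_ ?_
  · rintro ⟨τ, σ⟩ hx
    simp only [Finset.mem_filter, Finset.mem_univ, true_and] at hx ⊢
    obtain ⟨⟨h1, h2⟩, rfl⟩ := hx
    rw [descents_subset_partialSums_iff] at h1 h2 ⊢
    intro a b hab he
    rw [shuffleComp_index] at he
    exact h2 _ _ (h1 a b hab he.1) he.2
  · intro π hπ
    simp only [Finset.mem_filter, Finset.mem_univ, true_and] at hπ ⊢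
    rw [descents_subset_partialSums_iff] at hπ
    have hsort := ((Tuple.eq_sort_iff (f := u ∘ π.symm)
      (σ := Tuple.sort (u ∘ π.symm))).1 rfl).2
    have hi := comp_sort_eq_index (hv π)
    set σ := Tuple.sort (u ∘ π.symm)
    have hi' : ∀ a, q.index (σ⁻¹ (π a)) = u a := by
      intro a
      rw [← hi]
      simp
    have hσd : ∀ a b, a < b → q.index a = q.index b → σ a < σ b := by
      intro a b hab he
      rw [← hi] at he
      exact hsort a b hab he
    refine ⟨⟨?_, descents_subset_partialSums_iff.2 hσd⟩, funext hi'⟩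
    rw [descents_subset_partialSums_iff]
    intro a b hab he
    by_contra h2
    rcases eq_or_lt_of_le (hu.1 a b hab he) with h | h
    · rcases eq_or_lt_of_le (not_lt.1 h2) with h3 | h3
      · exact hab.ne ((σ⁻¹ * π).injective h3.symm)
      · have h4 := hσd _ _ h3 ((hi' b).trans (h.symm.trans (hi' a).symm))
        simp only [Perm.coe_mul, Function.comp_apply, Perm.inv_def, apply_symm_apply] at h4
        exact absurd (hπ a b hab ((shuffleComp_index hu a b).2 ⟨he, h⟩)) (not_lt.2 h4.le)
    · have := index_mono q (not_lt.1 h2)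
      simp only [Perm.coe_mul, Function.comp_apply, hi'] at this
      exact absurd h (not_lt.2 this)
  · rintro ⟨τ, σ⟩ hx
    simp only [Finset.mem_filter, Finset.mem_univ, true_and] at hx
    obtain ⟨⟨-, h2⟩, rfl⟩ := hx
    rw [descents_subset_partialSums_iff] at h2
    have hf : ∀ a, ((q.index ∘ τ) ∘ (σ * τ).symm) (σ a) = q.index a := by
      intro a
      have h0 : (σ * τ).symm (σ a) = τ.symm a := by
        rw [Equiv.symm_apply_eq]
        simp
      rw [Function.comp_apply, h0]
      simp
    have hσ : σ = Tuple.sort ((q.index ∘ τ) ∘ (σ * τ).symm) := by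
      rw [Tuple.eq_sort_iff]
      refine ⟨fun a b hab => ?_, fun i j hij h => ?_⟩
      · rw [Function.comp_apply, hf, Function.comp_apply, hf]
        exact index_mono q hab
      · rw [hf, hf] at h
        exact h2 i j hij h
    simp only [← hσ, inv_mul_cancel_left]
  · intro π _
    simp
  · intro x _
    rfl

open Classical in
/-- The product rule: the terms of `Ξ^r Ξ^q` correspond to the matrices of natural numbers with row
sums `r` and column sums `q`. -/
theorem xi_mul_xi (F : Type*) [Field F] (r q : Composition n) :
    xi F r * xi F q = ∑ u : {u : Fin n → Fin q.length // IsShuffle r q u},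
      xi F (shuffleComp u.2) := by
  have e1 : xi F r * xi F q = ∑ x : Perm (Fin n) × Perm (Fin n) with
      descents x.1 ⊆ partialSums r ∧ descents x.2 ⊆ partialSums q,
      MonoidAlgebra.single (MulOpposite.op (x.2 * x.1)) (1 : F) := by
    rw [xi, xi, Finset.sum_mul_sum, ← Finset.sum_product']
    refine Finset.sum_congr ?_ fun x _ => ?_
    · ext x
      simp
    · rw [MonoidAlgebra.single_mul_single, mul_one, ← MulOpposite.op_mul]
  rw [e1, ← Finset.sum_fiberwise_of_maps_to (g := fun x => q.index ∘ x.1)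
    (t := Finset.univ.filter (IsShuffle r q)) fun x hx => by
      simp only [Finset.mem_filter, Finset.mem_univ, true_and] at hx ⊢
      exact IsShuffle.of_descents hx.1]
  rw [Finset.sum_subtype (p := IsShuffle r q) _ fun u => by simp]
  refine Finset.sum_congr rfl fun u _ => ?_
  rw [Finset.filter_filter, ← sum_shuffle_eq_xi F u.2]

theorem weakRefines_shuffleComp_left {r q : Composition n} {u : Fin n → Fin q.length}
    (hu : IsShuffle r q u) : WeakRefines (shuffleComp hu) r :=
  weakRefines_of_index r.index (card_index_eq r) fun a b h => ((shuffleComp_index hu a b).1 h).1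

theorem weakRefines_shuffleComp_right {r q : Composition n} {u : Fin n → Fin q.length}
    (hu : IsShuffle r q u) : WeakRefines (shuffleComp hu) q :=
  weakRefines_of_index u hu.2 fun a b h => ((shuffleComp_index hu a b).1 h).2

/-- The ways to distribute the parts of `r` over the parts of `q` so that the parts of `r` assigned
to each part of `q` sum to it. -/
abbrev PartMap (r q : Composition n) : Type :=
  {t : Fin r.length → Fin q.length // ∀ j, ∑ i with t i = j, r.blocksFun i = q.blocksFun j}

theorem PartMap.weakRefines {r q : Composition n} (t : PartMap r q) : WeakRefines r q :=
  weakRefines_of_map t.1 t.2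

theorem PartMap.isShuffle {r q : Composition n} (t : PartMap r q) :
    IsShuffle r q (t.1 ∘ r.index) :=
  ⟨fun a b _ he => by simp only [Function.comp_apply, he, le_refl], fun j => by
    rw [← t.2 j, sum_blocksFun_of_index]
    rfl⟩

open Classical in
/-- Multiplication from the right by `Ξ^q` is triangular: the coefficient of `Ξ^r` in `Ξ^r Ξ^q`
counts the matrices with only one nonzero entry in each row, and all other terms belong to
compositions that are finer than `r`. -/
theorem xiD_mul_xiD (F : Type*) [Field F] (r q : Composition n) :
    ∃ y ∈ Submodule.span F (xiD F '' {s | WeakRefines s r ∧ WeakRefines s q ∧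
      r.length < s.length}),
      xiD F r * xiD F q = (Fintype.card (PartMap r q) : F) • xiD F r + y := by
  have h0 : xiD F r * xiD F q = ∑ u : {u : Fin n → Fin q.length // IsShuffle r q u},
      xiD F (shuffleComp u.2) := by
    apply Subtype.ext
    simpa [xiD] using xi_mul_xi F r q
  have hr : ∀ u : {u : Fin n → Fin q.length // IsShuffle r q u},
      (∀ a b, r.index a = r.index b → u.1 a = u.1 b) → shuffleComp u.2 = r := fun u h =>
    eq_of_index_iff fun a b => by
      rw [shuffleComp_index]
      exact ⟨fun h => h.1, fun he => ⟨he, h a b he⟩⟩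
  rw [h0, ← Finset.sum_filter_add_sum_filter_not _
    (fun u => ∀ a b, r.index a = r.index b → u.1 a = u.1 b)]
  refine ⟨_, Submodule.sum_mem _ fun u hu => Submodule.subset_span
    ⟨_, ⟨weakRefines_shuffleComp_left u.2, weakRefines_shuffleComp_right u.2, ?_⟩, rfl⟩,
    congrArg (· + _) ?_⟩
  · refine length_lt_of_index (fun a b h => ((shuffleComp_index u.2 a b).1 h).1) ?_
    simp only [Finset.mem_filter, Finset.mem_univ, true_and] at hu
    push Not at hu
    obtain ⟨a, b, h1, h2⟩ := hu
    exact ⟨a, b, h1, fun h => h2 ((shuffleComp_index u.2 a b).1 h).2⟩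
  · rw [Finset.sum_congr rfl (g := fun _ => xiD F r) fun u hu => by
      rw [hr u (Finset.mem_filter.1 hu).2], Finset.sum_const, ← Nat.cast_smul_eq_nsmul F]
    congr 2
    symm
    rw [← Finset.card_univ]
    refine Finset.card_bij (fun t _ => ⟨t.1 ∘ r.index, t.isShuffle⟩) ?_ ?_ ?_
    · intro t _
      simp only [Finset.mem_filter, Finset.mem_univ, true_and, Function.comp_apply]
      exact fun a b h => by rw [h]
    · intro t _ t' _ h
      exact Subtype.ext ((index_surjective r).injective_comp_right (Subtype.ext_iff.1 h))
    · rintro ⟨u, hu⟩ h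
      simp only [Finset.mem_filter, Finset.mem_univ, true_and] at h
      obtain ⟨t, ht⟩ := exists_comp_index h
      have ht' : t ∘ r.index = u := funext ht
      exact ⟨⟨t, fun j => by rw [sum_blocksFun_of_index, ← hu.2 j, ← ht']; rfl⟩,
        Finset.mem_univ _, Subtype.ext ht'⟩

/-! ### Cycle types and fixed tabloids -/

theorem pow_apply_eq_self_iff (σ : Perm (Fin n)) (k : ℕ) (x : Fin n) :
    (σ ^ k) x = x ↔ Function.minimalPeriod σ x ∣ k := by
  rw [← Function.isPeriodicPt_iff_minimalPeriod_dvd, Function.IsPeriodicPt, Function.IsFixedPt,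
    Equiv.Perm.iterate_eq_pow]

theorem minimalPeriod_eq_card_cycleOf {σ : Perm (Fin n)} {x : Fin n} (hx : σ x ≠ x) :
    Function.minimalPeriod σ x = (σ.cycleOf x).support.card := by
  have h := σ.isCycleOn_support_cycleOf x
  have hm : x ∈ (σ.cycleOf x).support := by
    rw [Perm.mem_support_cycleOf_iff]
    exact ⟨Perm.SameCycle.refl _ _, Perm.mem_support.2 hx⟩
  refine Nat.dvd_antisymm ?_ ?_
  · rw [← pow_apply_eq_self_iff, h.pow_apply_eq hm]
  · rw [← h.pow_apply_eq hm, pow_apply_eq_self_iff]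

theorem card_minimalPeriod_eq (σ : Perm (Fin n)) (l : ℕ) :
    (Finset.univ.filter fun x => Function.minimalPeriod σ x = l).card =
      l * σ.partition.parts.count l := by
  rw [Perm.parts_partition, Multiset.count_add, Multiset.count_replicate, Fintype.card_fin]
  by_cases h1 : l = 1
  · subst h1
    have h0 : Multiset.count 1 σ.cycleType = 0 := Multiset.count_eq_zero.2 fun h => by
      have := Perm.two_le_of_mem_cycleType h
      omega
    rw [h0, if_pos rfl, zero_add, one_mul]
    have h2 : (Finset.univ.filter fun x => Function.minimalPeriod σ x = 1) = σ.supportᶜ := by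
      ext x
      simp only [Finset.mem_filter, Finset.mem_univ, true_and,
        Function.minimalPeriod_eq_one_iff_isFixedPt, Function.IsFixedPt, Finset.mem_compl,
        Perm.mem_support, not_not]
    rw [h2, Finset.card_compl, Fintype.card_fin]
  · rw [if_neg (Ne.symm h1), add_zero, Perm.cycleType_def, Multiset.count_map]
    have hp : ∀ x, Function.minimalPeriod σ x = l → σ x ≠ x := fun x hx h => h1 (by
      rw [← hx]
      exact Function.minimalPeriod_eq_one_iff_isFixedPt.2 h)
    have h2 := Finset.card_eq_sum_card_fiberwise (f := σ.cycleOf)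
      (s := Finset.univ.filter fun x => Function.minimalPeriod σ x = l)
      (t := σ.cycleFactorsFinset.filter fun c => l = c.support.card) (by
        intro x hx
        have hx' : Function.minimalPeriod σ x = l := by simpa using hx
        simp only [Finset.coe_filter, Set.mem_ofPred_eq]
        exact ⟨Perm.cycleOf_mem_cycleFactorsFinset_iff.2 (Perm.mem_support.2 (hp x hx')), by
          rw [← minimalPeriod_eq_card_cycleOf (hp x hx'), hx']⟩)
    rw [h2, Finset.sum_congr rfl (g := fun _ => l), Finset.sum_const, smul_eq_mul, mul_comm]
    · rfl
    · intro c hc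
      simp only [Finset.mem_filter] at hc
      obtain ⟨hc, rfl⟩ := hc
      congr 1
      ext x
      simp only [Finset.mem_filter, Finset.mem_univ, true_and]
      constructor
      · rintro ⟨h3, rfl⟩
        rw [Perm.mem_support_cycleOf_iff]
        exact ⟨Perm.SameCycle.refl _ _, Perm.mem_support.2 (hp x h3)⟩
      · intro hx
        have h4 := Perm.cycle_is_cycleOf hx hc
        have h5 : σ x ≠ x :=
          Perm.mem_support.1 (Perm.mem_cycleFactorsFinset_support_le hc hx)
        exact ⟨by rw [minimalPeriod_eq_card_cycleOf h5, ← h4], h4.symm⟩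

theorem parts_partition_eq {σ : Perm (Fin n)} {M : Multiset ℕ} (hM : 0 ∉ M)
    (h : ∀ l, 0 < l → (Finset.univ.filter fun x => Function.minimalPeriod σ x = l).card =
      l * M.count l) : σ.partition.parts = M := by
  ext l
  rcases Nat.eq_zero_or_pos l with rfl | hl
  · rw [Multiset.count_eq_zero.2 hM, Multiset.count_eq_zero.2 fun h =>
      (σ.partition.parts_pos h).ne' rfl]
  · exact Nat.eq_of_mul_eq_mul_left hl ((card_minimalPeriod_eq σ l).symm.trans (h l hl))

theorem isConj_of_parts_eq {σ τ : Perm (Fin n)} (h : σ.partition.parts = τ.partition.parts) :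
    IsConj σ τ :=
  Perm.partition_eq_of_isConj.2 (Nat.Partition.ext h)

theorem card_fixed_pow_eq_sum_divisors (σ : Perm (Fin n)) {k : ℕ} (hk : k ≠ 0) :
    (Finset.univ.filter fun x => (σ ^ k) x = x).card =
      ∑ d ∈ k.divisors, (Finset.univ.filter fun x => Function.minimalPeriod σ x = d).card := by
  rw [Finset.card_eq_sum_card_fiberwise (f := Function.minimalPeriod σ) (t := k.divisors)]
  · refine Finset.sum_congr rfl fun d hd => ?_
    congr 1
    ext x
    simp only [Finset.mem_filter, Finset.mem_univ, true_and, pow_apply_eq_self_iff]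
    constructor
    · exact fun h => h.2
    · rintro rfl
      exact ⟨Nat.dvd_of_mem_divisors hd, rfl⟩
  · intro x hx
    have hx' : (σ ^ k) x = x := by simpa using hx
    exact Finset.mem_coe.2 (Nat.mem_divisors.2 ⟨(pow_apply_eq_self_iff σ k x).1 hx', hk⟩)

/-- The numbers of fixed points of the powers determine the conjugacy class. -/
theorem isConj_of_card_fixed_eq {σ τ : Perm (Fin n)}
    (h : ∀ k, (Finset.univ.filter fun x => (σ ^ k) x = x).card =
      (Finset.univ.filter fun x => (τ ^ k) x = x).card) : IsConj σ τ := by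
  have key : ∀ l, 0 < l → (Finset.univ.filter fun x => Function.minimalPeriod σ x = l).card =
      (Finset.univ.filter fun x => Function.minimalPeriod τ x = l).card := by
    intro l
    induction l using Nat.strong_induction_on with
    | _ l ih =>
      intro hl
      have h1 := h l
      rw [card_fixed_pow_eq_sum_divisors σ hl.ne', card_fixed_pow_eq_sum_divisors τ hl.ne',
        ← Nat.cons_self_properDivisors hl.ne', Finset.sum_cons, Finset.sum_cons,
        Finset.sum_congr rfl fun d hd => ih d (Nat.mem_properDivisors.1 hd).2
          (Nat.pos_of_mem_properDivisors hd)] at h1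
      exact Nat.add_right_cancel h1
  refine isConj_of_parts_eq (parts_partition_eq (fun h => (τ.partition.parts_pos h).ne' rfl) ?_)
  intro l hl
  rw [key l hl, card_minimalPeriod_eq]

theorem card_fixed_pow (σ : Perm (Fin n)) (k : ℕ) :
    (Finset.univ.filter fun x => (σ ^ k) x = x).card =
      (σ.partition.parts.map fun l => if l ∣ k then l else 0).sum := by
  rw [Finset.sum_multiset_map_count, Finset.card_eq_sum_card_fiberwise
    (f := Function.minimalPeriod σ) (t := σ.partition.parts.toFinset)]
  · refine Finset.sum_congr rfl fun l _ => ?_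
    rw [Finset.filter_filter, smul_eq_mul]
    split_ifs with h
    · rw [mul_comm, ← card_minimalPeriod_eq]
      congr 1
      ext x
      simp only [Finset.mem_filter, Finset.mem_univ, true_and, pow_apply_eq_self_iff]
      constructor
      · exact fun h => h.2
      · rintro rfl
        exact ⟨h, rfl⟩
    · rw [mul_zero, Finset.card_eq_zero, Finset.filter_eq_empty_iff]
      rintro x - ⟨h1, rfl⟩
      exact h ((pow_apply_eq_self_iff σ k x).1 h1)
  · intro x _
    simp only [Finset.mem_coe, Multiset.mem_toFinset, ← Multiset.count_pos]
    have h1 : 0 < (Finset.univ.filter fun y =>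
        Function.minimalPeriod σ y = Function.minimalPeriod σ x).card :=
      Finset.card_pos.2 ⟨x, by simp⟩
    rw [card_minimalPeriod_eq] at h1
    exact Nat.pos_of_mul_pos_left h1

theorem numFixedTabloids_congr (q : Composition n) {σ τ : Perm (Fin n)} (h : IsConj σ τ) :
    numFixedTabloids q σ = numFixedTabloids q τ := by
  obtain ⟨ρ, rfl⟩ := isConj_iff.1 h
  refine Fintype.card_congr (Equiv.subtypeEquiv (ρ.arrowCongr (Equiv.refl _)) fun t => ?_)
  refine and_congr (forall_congr' fun j => ?_) ?_
  · rw [Finset.card_bij (t := Finset.univ.filter fun x => ρ.arrowCongr (Equiv.refl _) t x = j)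
      (fun a _ => ρ a) (by simp) (fun _ _ _ _ h => ρ.injective h)
      fun b hb => ⟨ρ.symm b, by simpa using hb, by simp⟩]
  · constructor
    · intro h x
      simpa using h (ρ.symm x)
    · intro h x
      simpa using h (ρ x)

/-- The permutation that rotates each block of the composition `r`. -/
def blockRotate (r : Composition n) : Perm (Fin n) :=
  r.blocksFinEquiv.permCongr (Equiv.sigmaCongrRight fun i => finRotate (r.blocksFun i))

theorem blockRotate_pow_embedding (r : Composition n) (k : ℕ) (i : Fin r.length)
    (x : Fin (r.blocksFun i)) :
    (blockRotate r ^ k) (r.embedding i x) = r.embedding i ((finRotate (r.blocksFun i) ^ k) x) := by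
  induction k with
  | zero => rfl
  | succ k ih =>
    rw [pow_succ', pow_succ', Perm.mul_apply, ih, Perm.mul_apply]
    have h : ∀ y, r.embedding i y = r.blocksFinEquiv ⟨i, y⟩ := fun _ => rfl
    rw [h, h, blockRotate, Equiv.permCongr_apply, Equiv.symm_apply_apply]
    rfl

theorem finRotate_pow_apply {m : ℕ} (k : ℕ) (x : Fin m) :
    (((finRotate m ^ k) x : Fin m) : ℕ) = (x + k) % m := by
  obtain ⟨m, rfl⟩ : ∃ l, m = l + 1 := ⟨m - 1, by have := x.2; omega⟩
  induction k with
  | zero => simp [Nat.mod_eq_of_lt x.2]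
  | succ k ih =>
    rw [pow_succ', Perm.mul_apply, finRotate_apply, Fin.val_add, ih, Fin.val_one']
    rw [← Nat.add_mod, add_assoc]

theorem minimalPeriod_blockRotate (r : Composition n) (x : Fin n) :
    Function.minimalPeriod (blockRotate r) x = r.blocksFun (r.index x) := by
  have key : ∀ k, Function.minimalPeriod (blockRotate r) x ∣ k ↔ r.blocksFun (r.index x) ∣ k := by
    intro k
    rw [← pow_apply_eq_self_iff]
    conv_lhs => rw [← r.embedding_comp_inv x]
    rw [blockRotate_pow_embedding, (r.embedding _).injective.eq_iff, Fin.ext_iff,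
      finRotate_pow_apply]
    constructor
    · intro h
      have h1 : (r.invEmbedding x : ℕ) + k ≡ r.invEmbedding x + 0 [MOD r.blocksFun (r.index x)] := by
        rw [Nat.ModEq, h, add_zero, Nat.mod_eq_of_lt (r.invEmbedding x).2]
      exact (Nat.modEq_zero_iff_dvd).1 (Nat.ModEq.add_left_cancel' _ h1)
    · rintro ⟨c, rfl⟩
      rw [Nat.add_mul_mod_self_left, Nat.mod_eq_of_lt (r.invEmbedding x).2]
  exact Nat.dvd_antisymm ((key _).2 dvd_rfl) ((key _).1 dvd_rfl)

theorem parts_blockRotate (r : Composition n) : (blockRotate r).partition.parts = r.blocks := by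
  refine parts_partition_eq (fun h => (r.blocks_pos (Multiset.mem_coe.1 h)).ne' rfl) fun l _ => ?_
  simp only [minimalPeriod_blockRotate]
  rw [Finset.card_eq_sum_card_fiberwise (f := r.index)
    (t := Finset.univ.filter fun i => r.blocksFun i = l) (by intro a ha; simpa using ha),
    Finset.sum_congr rfl (g := fun _ => l), Finset.sum_const, smul_eq_mul, mul_comm]
  · congr 1
    rw [← r.ofFn_blocksFun, List.ofFn_eq_map, ← Multiset.map_coe, Multiset.count_map]
    simp only [eq_comm (a := l)]
    rfl
  · intro i hi
    simp only [Finset.mem_filter, Finset.mem_univ, true_and] at hi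
    conv_rhs => rw [← hi, ← card_index_eq]
    rw [Finset.filter_filter]
    congr 1
    ext a
    simp only [Finset.mem_filter, Finset.mem_univ, true_and]
    constructor
    · exact fun h => h.2
    · rintro rfl
      exact ⟨hi, rfl⟩

theorem invariant_blockRotate_iff (r : Composition n) {β : Type*} (t : Fin n → β) :
    (∀ x, t (blockRotate r x) = t x) ↔ ∀ a b, r.index a = r.index b → t a = t b := by
  constructor
  · intro h
    have hk : ∀ k x, t ((blockRotate r ^ k) x) = t x := by
      intro k
      induction k with
      | zero => exact fun _ => rfl
      | succ k ih => exact fun x => by rw [pow_succ', Perm.mul_apply, h, ih]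
    have h0 : ∀ i (x : Fin (r.blocksFun i)),
        t (r.embedding i x) = t (r.embedding i ⟨0, r.one_le_blocksFun i⟩) := by
      intro i x
      rw [← hk x (r.embedding i ⟨0, r.one_le_blocksFun i⟩), blockRotate_pow_embedding]
      congr 2
      apply Fin.ext
      rw [finRotate_pow_apply, Nat.zero_add, Nat.mod_eq_of_lt x.2]
    intro a b hab
    rw [← r.embedding_comp_inv a, ← r.embedding_comp_inv b, h0 (r.index a), h0 (r.index b), hab]
  · intro h x
    apply h
    conv_lhs => rw [← r.embedding_comp_inv x]
    have := blockRotate_pow_embedding r 1 (r.index x) (r.invEmbedding x)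
    rw [pow_one] at this
    rw [this, r.index_embedding]

/-- A tabloid fixed by a permutation is constant on its cycles, so it distributes the cycles over
the rows. -/
theorem numFixedTabloids_eq (r q : Composition n) {σ : Perm (Fin n)}
    (h : σ.partition.parts = r.blocks) : numFixedTabloids q σ = Fintype.card (PartMap r q) := by
  rw [numFixedTabloids_congr q (isConj_of_parts_eq (h.trans (parts_blockRotate r).symm))]
  symm
  refine Fintype.card_congr (Equiv.ofBijective (fun t => ⟨t.1 ∘ r.index, t.isShuffle.2,
    (invariant_blockRotate_iff r _).2 fun a b h => by simp only [Function.comp_apply, h]⟩)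
    ⟨fun t t' h => Subtype.ext ((index_surjective r).injective_comp_right (Subtype.ext_iff.1 h)),
    ?_⟩)
  rintro ⟨u, hu1, hu2⟩
  obtain ⟨t, ht⟩ := exists_comp_index ((invariant_blockRotate_iff r u).1 hu2)
  have ht' : t ∘ r.index = u := funext ht
  exact ⟨⟨t, fun j => by rw [sum_blocksFun_of_index, ← hu1 j, ← ht']; rfl⟩, Subtype.ext ht'⟩

theorem toComp_blocks (μ : n.Partition) : ((toComp μ).blocks : Multiset ℕ) = μ.parts :=
  Multiset.sort_eq _ _

theorem youngChar_eq (F : Type*) [Field F] (q r : Composition n) (μ : n.Partition)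
    (h : μ.parts = r.blocks) : youngChar F q μ = Fintype.card (PartMap r q) := by
  rw [youngChar, numFixedTabloids_eq r q]
  exact (exists_hasType μ).choose_spec.trans h

theorem youngChar_eq_of_hasType (F : Type*) [Field F] (q : Composition n) {μ : n.Partition}
    {σ : Perm (Fin n)} (h : HasType σ μ) : youngChar F q μ = numFixedTabloids q σ := by
  rw [youngChar, numFixedTabloids_congr q
    (isConj_of_parts_eq ((exists_hasType μ).choose_spec.trans h.symm))]

theorem weakRefines_of_youngChar_ne_zero {F : Type*} [Field F] {lam μ : n.Partition}
    (h : youngChar F (toComp lam) μ ≠ 0) : WeakRefines (toComp μ) (toComp lam) := by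
  rw [youngChar_eq F _ (toComp μ) μ (toComp_blocks μ).symm] at h
  have : Nonempty (PartMap (toComp μ) (toComp lam)) := by
    by_contra hne
    rw [not_nonempty_iff] at hne
    exact h (by simp)
  exact this.some.weakRefines

theorem PartMap.surjective {r q : Composition n} (t : PartMap r q) : Function.Surjective t.1 := by
  intro j
  have h1 : 0 < ∑ i with t.1 i = j, r.blocksFun i := by
    rw [t.2 j]
    exact q.one_le_blocksFun j
  obtain ⟨i, hi, -⟩ := Finset.exists_ne_zero_of_sum_ne_zero h1.ne'
  exact ⟨i, (Finset.mem_filter.1 hi).2⟩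

theorem card_partMap_self (q : Composition n) :
    Fintype.card (PartMap q q) =
      ∏ i ∈ (q.blocks : Multiset ℕ).toFinset, ((q.blocks : Multiset ℕ).count i).factorial := by
  have hb : (q.blocks : Multiset ℕ) = Finset.univ.val.map q.blocksFun := by
    rw [← q.ofFn_blocksFun, List.ofFn_eq_map, ← Multiset.map_coe]
    rfl
  have h1 := DomMulAct.stabilizer_card' q.blocksFun
  have h2 : ∀ t : Fin q.length → Fin q.length, Function.Injective t → ∀ a,
      ∑ i with t i = t a, q.blocksFun i = q.blocksFun a := fun t ht a => by
    simp only [ht.eq_iff, Finset.sum_filter, Finset.sum_ite_eq', Finset.mem_univ, if_true]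
  have h3 : Fintype.card (PartMap q q) =
      Fintype.card {g : Perm (Fin q.length) // q.blocksFun ∘ g = q.blocksFun} := by
    symm
    refine Fintype.card_congr (Equiv.ofBijective (fun g => ⟨g.1, fun j => ?_⟩) ⟨fun g g' h => ?_, ?_⟩)
    · obtain ⟨a, rfl⟩ := g.1.surjective j
      rw [h2 _ g.1.injective]
      exact (congrFun g.2 a).symm
    · exact Subtype.ext (DFunLike.coe_injective (Subtype.ext_iff.1 h))
    · intro t
      have hi := Finite.injective_iff_surjective.2 t.surjective
      exact ⟨⟨Equiv.ofBijective t.1 ⟨hi, t.surjective⟩, funext fun a => by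
        rw [← h2 t.1 hi a, t.2 (t.1 a)]
        rfl⟩, rfl⟩
  rw [h3, h1]
  refine Finset.prod_congr ?_ fun i _ => ?_
  · rw [hb]
    rfl
  · rw [hb, Multiset.count_map, Fintype.card_subtype]
    exact congrArg Nat.factorial (congrArg Finset.card (Finset.filter_congr fun _ _ => eq_comm))

theorem youngChar_self (F : Type*) [Field F] (lam : n.Partition) :
    youngChar F (toComp lam) lam = multFactorial lam := by
  rw [youngChar_eq F _ (toComp lam) lam (toComp_blocks lam).symm, card_partMap_self, multFactorial,
    toComp_blocks]

/-! ### `p`-equivalence of cycle types -/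

/-- An exponent `N` such that `σ ^ N` is the `p'`-part of `σ`, for all permutations `σ` of `n`
elements: writing `n! = p ^ A * m` with `m` coprime to `p`, it is divisible by `p ^ A` and
congruent to `1` modulo `m`. -/
def IsPPrimeExponent (p n N : ℕ) : Prop :=
  ∃ A m : ℕ, n.factorial = p ^ A * m ∧ p.Coprime m ∧ p ^ A ∣ N ∧ N ≡ 1 [MOD m]

theorem exists_isPPrimeExponent (p : ℕ) [hp : Fact p.Prime] (n : ℕ) :
    ∃ N, IsPPrimeExponent p n N := by
  obtain ⟨A, m, h1, h2⟩ :=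
    Nat.exists_eq_pow_mul_and_not_dvd n.factorial_ne_zero p hp.out.ne_one
  have h3 := (Nat.Prime.coprime_iff_not_dvd hp.out).2 h1
  obtain ⟨N, h4, h5⟩ := Nat.chineseRemainder (h3.pow_left A) 0 1
  exact ⟨N, A, m, h2, h3, (Nat.modEq_zero_iff_dvd).1 h4, h5⟩

theorem orderOf_dvd_factorial (σ : Perm (Fin n)) : orderOf σ ∣ n.factorial := by
  have := orderOf_dvd_card (x := σ)
  rwa [Fintype.card_perm, Fintype.card_fin] at this

/-- The complementary factor to the `p'`-part `σ ^ N` has `p`-power order. -/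
theorem IsPPrimeExponent.pow_eq_one {p N : ℕ} (hN : IsPPrimeExponent p n N) :
    ∃ A, ∀ σ : Perm (Fin n), (σ * (σ ^ N)⁻¹) ^ p ^ A = 1 := by
  obtain ⟨A, m, h1, h2, h3, h4⟩ := hN
  refine ⟨A, fun σ => ?_⟩
  have hc : Commute σ (σ ^ N)⁻¹ := ((Commute.refl σ).pow_right N).inv_right
  rw [hc.mul_pow, inv_pow, ← pow_mul, mul_inv_eq_one]
  refine pow_eq_pow_iff_modEq.2 (Nat.ModEq.of_dvd (orderOf_dvd_factorial σ) ?_)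
  rw [h1, mul_comm N]
  simpa using (h4.symm.mul_left' (p ^ A))

theorem IsPPrimeExponent.isPPrimePart {p N : ℕ} [hp : Fact p.Prime] (hN : IsPPrimeExponent p n N)
    (σ : Perm (Fin n)) : IsPPrimePart p σ (σ ^ N) := by
  obtain ⟨B, hB⟩ := hN.pow_eq_one
  obtain ⟨A, m, h1, h2, ⟨c, rfl⟩, h4⟩ := hN
  refine ⟨σ * (σ ^ (p ^ A * c))⁻¹, by simp, ?_, ?_, ?_⟩
  · have hc : Commute σ (σ ^ (p ^ A * c)) := (Commute.refl σ).pow_right _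
    exact hc.mul_left (Commute.refl _).inv_left
  · obtain ⟨k, -, hk⟩ := (Nat.dvd_prime_pow hp.out).1 (orderOf_dvd_of_pow_eq_one (hB σ))
    exact ⟨k, hk⟩
  · refine Nat.Coprime.coprime_dvd_left ?_ h2.symm
    rw [orderOf_dvd_iff_pow_eq_one, ← pow_mul, ← orderOf_dvd_iff_pow_eq_one]
    exact (orderOf_dvd_factorial σ).trans ⟨c, by rw [h1]; ring⟩

theorem IsPPrimeExponent.eq_pow {p N : ℕ} (hN : IsPPrimeExponent p n N)
    {σ τ : Perm (Fin n)} (h : IsPPrimePart p σ τ) : τ = σ ^ N := by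
  obtain ⟨A, m, h1, h2, h3, h4⟩ := hN
  obtain ⟨u, rfl, hc, ⟨k, hk⟩, hτ⟩ := h
  have hu : u ^ N = 1 := by
    rw [← orderOf_dvd_iff_pow_eq_one]
    refine Nat.dvd_trans ?_ h3
    refine Nat.Coprime.dvd_of_dvd_mul_right (n := m) ?_ (h1 ▸ orderOf_dvd_factorial u)
    rw [hk]
    exact h2.pow_left k
  have ht : τ ^ N = τ ^ 1 := by
    refine pow_eq_pow_iff_modEq.2 (h4.of_dvd ?_)
    exact Nat.Coprime.dvd_of_dvd_mul_left (hτ.pow_right A) (h1 ▸ orderOf_dvd_factorial τ)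
  rw [hc.mul_pow, hu, ht, one_mul, pow_one]

theorem IsPPrimeExponent.mul_dvd {p N l k : ℕ} [hp : Fact p.Prime] (hN : IsPPrimeExponent p n N)
    (h0 : l ≠ 0) (hl : p * l ≤ n) (h : l ∣ N * k) : p * l ∣ N * k := by
  obtain ⟨A, m, h1, h2, h3, h4⟩ := hN
  obtain ⟨b, c, hc, hb⟩ := Nat.exists_eq_pow_mul_and_not_dvd h0 p hp.out.ne_one
  have hpc : p.Coprime c := (Nat.Prime.coprime_iff_not_dvd hp.out).2 hc
  have hl' : p * l = p ^ (b + 1) * c := by rw [hb]; ring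
  rw [hl']
  refine (hpc.pow_left (b + 1)).mul_dvd_of_dvd_of_dvd ?_ ((Dvd.intro_left _ hb.symm).trans h)
  refine Dvd.dvd.mul_right (Nat.dvd_trans ?_ h3) k
  refine Nat.Coprime.dvd_of_dvd_mul_right (h2.pow_left (b + 1)) ?_
  rw [← h1]
  refine Nat.dvd_trans (Dvd.intro _ hl'.symm) (Nat.dvd_factorial ?_ hl)
  exact Nat.mul_pos hp.out.pos (Nat.pos_of_ne_zero h0)

theorem PEquiv.isConj {p N : ℕ} [Fact p.Prime] (hN : IsPPrimeExponent p n N) {lam μ : n.Partition}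
    (h : PEquiv p lam μ) {σ τ : Perm (Fin n)} (hσ : HasType σ lam) (hτ : HasType τ μ) :
    IsConj (σ ^ N) (τ ^ N) :=
  h σ τ _ _ hσ hτ (hN.isPPrimePart σ) (hN.isPPrimePart τ)

/-- The tabloids fixed by `σ` are the fixed points of its `p`-part on the set of the tabloids fixed
by its `p'`-part. -/
theorem numFixedTabloids_pow_modEq {p N : ℕ} [Fact p.Prime] (hN : IsPPrimeExponent p n N)
    (q : Composition n) (σ : Perm (Fin n)) :
    numFixedTabloids q (σ ^ N) ≡ numFixedTabloids q σ [MOD p] := by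
  classical
  obtain ⟨A, hA⟩ := hN.pow_eq_one
  have hA := hA σ
  obtain ⟨u, hu⟩ : ∃ u, u = σ * (σ ^ N)⁻¹ := ⟨_, rfl⟩
  rw [← hu] at hA
  have hσ : ∀ x, σ x = u ((σ ^ N) x) := fun x => by
    rw [← Perm.mul_apply, hu, inv_mul_cancel_right]
  have hcu : Commute u (σ ^ N) := by
    rw [hu]
    exact ((Commute.refl σ).pow_right N).mul_left (Commute.refl _).inv_left
  let T := {t : Fin n → Fin q.length //
    (∀ j, (Finset.univ.filter fun x => t x = j).card = q.blocksFun j) ∧ ∀ x, t ((σ ^ N) x) = t x}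
  let f : Function.End T := fun t => ⟨t.1 ∘ u, fun j => by
    rw [← t.2.1 j]
    exact Finset.card_bij (fun a _ => u a) (by simp) (fun _ _ _ _ h => u.injective h)
      fun b hb => ⟨u⁻¹ b, by simpa using hb, by simp⟩, fun x => by
    have h1 : u ((σ ^ N) x) = (σ ^ N) (u x) := by
      rw [← Perm.mul_apply, hcu.eq, Perm.mul_apply]
    simp only [Function.comp_apply, h1, t.2.2]⟩
  have hf : ∀ k (t : T), ((f ^ k) t).1 = t.1 ∘ (u ^ k : Perm (Fin n)) := by
    intro k
    induction k with
    | zero => exact fun _ => rfl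
    | succ k ih =>
      intro t
      rw [pow_succ]
      change ((f ^ k) (f t)).1 = _
      rw [ih, pow_succ']
      rfl
  have h1 := Equiv.Perm.card_fixedPoints_modEq (f := f) (p := p) (n := A) (by
    funext t
    apply Subtype.ext
    rw [hf, hA]
    rfl)
  have hpow : ∀ t : Fin n → Fin q.length, (∀ x, t (σ x) = t x) → ∀ k x, t ((σ ^ k) x) = t x := by
    intro t h k
    induction k with
    | zero => exact fun _ => rfl
    | succ k ih => exact fun x => by rw [pow_succ', Perm.mul_apply, h, ih]
  have h2 : Fintype.card f.fixedPoints = numFixedTabloids q σ := by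
    refine Fintype.card_congr
      { toFun := fun t => ⟨t.1.1, t.1.2.1, fun x => ?_⟩
        invFun := fun t => ⟨⟨t.1, t.2.1, hpow t.1 t.2.2 N⟩, Subtype.ext (funext fun x => ?_)⟩
        left_inv := fun _ => rfl
        right_inv := fun _ => rfl }
    · have h3 : ∀ y, t.1.1 (u y) = t.1.1 y := fun y => congrFun (Subtype.ext_iff.1 t.2) y
      exact (congrArg t.1.1 (hσ x)).trans ((h3 _).trans (t.1.2.2 x))
    · change t.1 (u x) = t.1 x
      rw [hu, Perm.mul_apply, t.2.2, ← hpow t.1 t.2.2 N ((σ ^ N)⁻¹ x), ← Perm.mul_apply,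
        mul_inv_cancel, Perm.one_apply]
  rw [h2] at h1
  exact h1

theorem youngChar_eq_of_pEquiv {p : ℕ} [Fact p.Prime] (F : Type*) [Field F] [CharP F p]
    {lam μ : n.Partition} (h : PEquiv p lam μ) (q : Composition n) :
    youngChar F q lam = youngChar F q μ := by
  obtain ⟨N, hN⟩ := exists_isPPrimeExponent p n
  obtain ⟨σ, hσ⟩ := exists_hasType lam
  obtain ⟨τ, hτ⟩ := exists_hasType μ
  rw [youngChar_eq_of_hasType F q hσ, youngChar_eq_of_hasType F q hτ, CharP.cast_eq_iff_mod_eq F p]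
  refine (numFixedTabloids_pow_modEq hN q σ).symm.trans ?_
  rw [numFixedTabloids_congr q (h.isConj hN hσ hτ)]
  exact numFixedTabloids_pow_modEq hN q τ

theorem pEquiv_of_sum_eq {p N : ℕ} (hN : IsPPrimeExponent p n N) {lam μ : n.Partition}
    (h : ∀ k, (lam.parts.map fun l => if l ∣ N * k then l else 0).sum =
      (μ.parts.map fun l => if l ∣ N * k then l else 0).sum) : PEquiv p lam μ := by
  intro σ τ σ' τ' hσ hτ h1 h2
  rw [hN.eq_pow h1, hN.eq_pow h2]
  refine isConj_of_card_fixed_eq fun k => ?_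
  rw [← pow_mul, ← pow_mul, card_fixed_pow, card_fixed_pow, hσ, hτ]
  exact h k

/-- Every partition is `p`-equivalent to a `p`-regular one: replace `p` parts equal to `l` by one
part `p * l`, as long as possible. -/
theorem exists_regular_pEquiv (p : ℕ) [hp : Fact p.Prime] (μ : n.Partition) :
    ∃ lam : RegPartition n p, PEquiv p μ lam.1 := by
  obtain ⟨N, hN⟩ := exists_isPPrimeExponent p n
  suffices h : ∀ c, ∀ μ : n.Partition, Multiset.card μ.parts = c → ∃ lam : RegPartition n p,
      ∀ k, (μ.parts.map fun l => if l ∣ N * k then l else 0).sum =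
        (lam.1.parts.map fun l => if l ∣ N * k then l else 0).sum by
    obtain ⟨lam, hl⟩ := h _ μ rfl
    exact ⟨lam, pEquiv_of_sum_eq hN hl⟩
  intro c
  induction c using Nat.strong_induction_on with
  | _ c ih =>
    rintro μ rfl
    by_cases hr : ∀ i ∈ μ.parts, μ.parts.count i < p
    · exact ⟨⟨μ, hr⟩, fun _ => rfl⟩
    push Not at hr
    obtain ⟨i, hi, hpi⟩ := hr
    obtain ⟨R, hR⟩ := Multiset.le_iff_exists_add.1 (Multiset.le_count_iff_replicate_le.1 hpi)
    have hi0 := μ.parts_pos hi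
    have hsum : p * i + R.sum = n := by
      have := μ.parts_sum
      rwa [hR, Multiset.sum_add, Multiset.sum_replicate, smul_eq_mul] at this
    let ν : n.Partition :=
      { parts := (p * i) ::ₘ R
        parts_pos := by
          intro j hj
          rcases Multiset.mem_cons.1 hj with rfl | hj
          · exact Nat.mul_pos hp.out.pos hi0
          · exact μ.parts_pos (hR ▸ Multiset.mem_add.2 (Or.inr hj))
        parts_sum := by rw [Multiset.sum_cons, hsum] }
    have hcard : Multiset.card ν.parts < Multiset.card μ.parts := by
      rw [hR, Multiset.card_add, Multiset.card_replicate, Multiset.card_cons]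
      have := hp.out.two_le
      omega
    obtain ⟨lam, hl⟩ := ih _ hcard ν rfl
    refine ⟨lam, fun k => ?_⟩
    rw [← hl k, hR, Multiset.map_add, Multiset.sum_add, Multiset.map_cons, Multiset.sum_cons,
      Multiset.map_replicate, Multiset.sum_replicate, smul_eq_mul]
    congr 1
    by_cases h : i ∣ N * k
    · rw [if_pos h, if_pos (hN.mul_dvd hi0.ne' (by omega) h)]
    · rw [if_neg h, if_neg fun h' => h ((Dvd.intro_left p rfl).trans h'), mul_zero]

/-! ### Solomon's epimorphism is a homomorphism of algebras with nil kernel -/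

theorem solomonEpi_xiD (F : Type*) [Field F] (q : Composition n) :
    (solomonEpi F n (xiD F q) : n.Partition → F) = youngChar F q := by
  rw [solomonEpi, ← xiBasis_apply, Module.Basis.constr_basis]

theorem mem_span_xiD_iff {F : Type*} [Field F] {S : Set (Composition n)} {x : descentAlgebra F n} :
    x ∈ Submodule.span F (xiD F '' S) ↔ ↑((xiBasis F n).repr x).support ⊆ S := by
  rw [← Module.Basis.mem_span_image, show ⇑(xiBasis F n) = xiD F from funext (xiBasis_apply F)]

theorem descentAlgebra_induction {F : Type*} [Field F] {P : descentAlgebra F n → Prop}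
    (hx : ∀ q, P (xiD F q)) (h0 : P 0) (ha : ∀ x y, P x → P y → P (x + y))
    (hs : ∀ (a : F) x, P x → P (a • x)) (x : descentAlgebra F n) : P x := by
  have h : x ∈ Submodule.span F (Set.range (xiBasis F n)) := (xiBasis F n).mem_span x
  induction h using Submodule.span_induction with
  | mem x h =>
    obtain ⟨q, rfl⟩ := h
    rw [xiBasis_apply]
    exact hx q
  | zero => exact h0
  | add x y _ _ h1 h2 => exact ha x y h1 h2
  | smul a x _ h => exact hs a x h

/-- Right multiplication by `x` is triangular, with the diagonal entry at `Ξ^r` given by the value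
of Solomon's epimorphism at the cycle type `r`. -/
theorem xiD_mul (F : Type*) [Field F] {r : Composition n} {μ : n.Partition}
    (hμ : μ.parts = r.blocks) (x : descentAlgebra F n) :
    xiD F r * x - (solomonEpi F n x : n.Partition → F) μ • xiD F r ∈
      Submodule.span F (xiD F '' {s | WeakRefines s r ∧ r.length < s.length}) := by
  induction x using descentAlgebra_induction with
  | hx q =>
    obtain ⟨y, hy, he⟩ := xiD_mul_xiD F r q
    rw [solomonEpi_xiD, youngChar_eq F q r μ hμ, he]
    rw [show ∀ a : descentAlgebra F n, a + y - a = y from fun a => by abel]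
    exact Submodule.span_mono (Set.image_mono fun s hs => And.intro hs.1 hs.2.2) hy
  | h0 => simp
  | ha x y h1 h2 =>
    convert Submodule.add_mem _ h1 h2 using 1
    rw [map_add, Submodule.coe_add, Pi.add_apply, mul_add, add_smul]
    abel
  | hs a x h =>
    convert Submodule.smul_mem _ a h using 1
    rw [map_smul, Submodule.coe_smul, Pi.smul_apply, mul_smul_comm, smul_sub, smul_eq_mul, mul_smul]

theorem span_mul_mem {F : Type*} [Field F] {S : Set (Composition n)}
    (hS : ∀ r ∈ S, ∀ s, WeakRefines s r → s ∈ S) {z : descentAlgebra F n}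
    (hz : z ∈ Submodule.span F (xiD F '' S)) (x : descentAlgebra F n) :
    z * x ∈ Submodule.span F (xiD F '' S) := by
  induction hz using Submodule.span_induction with
  | mem z h =>
    obtain ⟨r, hr, rfl⟩ := h
    have h1 := xiD_mul F (μ := Nat.Partition.ofComposition n r) rfl x
    rw [← sub_add_cancel (xiD F r * x) _]
    exact Submodule.add_mem _
      (Submodule.span_mono (Set.image_mono fun s hs => hS r hr s hs.1) h1)
      (Submodule.smul_mem _ _ (Submodule.subset_span ⟨r, hr, rfl⟩))
  | zero => simp
  | add z w _ _ h1 h2 =>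
    rw [add_mul]
    exact Submodule.add_mem _ h1 h2
  | smul a z _ h =>
    rw [smul_mul_assoc]
    exact Submodule.smul_mem _ a h

theorem mul_span_mem {F : Type*} [Field F] {S : Set (Composition n)}
    (hS : ∀ r ∈ S, ∀ s, WeakRefines s r → s ∈ S) {z : descentAlgebra F n}
    (hz : z ∈ Submodule.span F (xiD F '' S)) (x : descentAlgebra F n) :
    x * z ∈ Submodule.span F (xiD F '' S) := by
  induction hz using Submodule.span_induction with
  | mem z h =>
    obtain ⟨q, hq, rfl⟩ := h
    induction x using descentAlgebra_induction with
    | hx r =>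
      by_cases h0 : Nonempty (PartMap r q)
      · obtain ⟨y, hy, he⟩ := xiD_mul_xiD F r q
        rw [he]
        exact Submodule.add_mem _
          (Submodule.smul_mem _ _ (Submodule.subset_span ⟨r, hS q hq r h0.some.weakRefines, rfl⟩))
          (Submodule.span_mono (Set.image_mono fun s hs => hS q hq s hs.2.1) hy)
      · obtain ⟨y, hy, he⟩ := xiD_mul_xiD F r q
        rw [not_nonempty_iff] at h0
        rw [he, Fintype.card_eq_zero, Nat.cast_zero, zero_smul, zero_add]
        exact Submodule.span_mono (Set.image_mono fun s hs => hS q hq s hs.2.1) hy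
    | h0 => simp
    | ha x y h1 h2 =>
      rw [add_mul]
      exact Submodule.add_mem _ h1 h2
    | hs a x h =>
      rw [smul_mul_assoc]
      exact Submodule.smul_mem _ a h
  | zero => simp
  | add z w _ _ h1 h2 =>
    rw [mul_add]
    exact Submodule.add_mem _ h1 h2
  | smul a z _ h =>
    rw [mul_smul_comm]
    exact Submodule.smul_mem _ a h

theorem eq_of_smul_xiD_sub_mem {F : Type*} [Field F] {r : Composition n} {a b : F}
    (h : a • xiD F r - b • xiD F r ∈
      Submodule.span F (xiD F '' {s | WeakRefines s r ∧ r.length < s.length})) : a = b := by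
  rw [mem_span_xiD_iff] at h
  by_contra hne
  have h1 : r ∈ ((xiBasis F n).repr (a • xiD F r - b • xiD F r)).support := by
    rw [Finsupp.mem_support_iff, ← sub_smul, ← xiBasis_apply, map_smul, Module.Basis.repr_self]
    simpa [sub_eq_zero] using hne
  exact lt_irrefl _ (h h1).2

theorem solomonEpi_one (F : Type*) [Field F] :
    (solomonEpi F n 1 : n.Partition → F) = 1 := by
  funext μ
  have h := xiD_mul F (toComp_blocks μ).symm 1
  rw [mul_one] at h
  exact (eq_of_smul_xiD_sub_mem (r := toComp μ) (by rwa [Pi.one_apply, one_smul])).symm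

theorem solomonEpi_mul {F : Type*} [Field F] (x y : descentAlgebra F n) :
    (solomonEpi F n (x * y) : n.Partition → F) =
      (solomonEpi F n x : n.Partition → F) * (solomonEpi F n y : n.Partition → F) := by
  funext μ
  have h1 := xiD_mul F (toComp_blocks μ).symm (x * y)
  have h2 := xiD_mul F (toComp_blocks μ).symm x
  have h3 := xiD_mul F (toComp_blocks μ).symm y
  have h4 := span_mul_mem (S := {s | WeakRefines s (toComp μ) ∧ (toComp μ).length < s.length})
    (fun r hr s hs => ⟨WeakRefines.trans hs hr.1, hr.2.trans_le (WeakRefines.length_le hs)⟩) h2 y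
  refine eq_of_smul_xiD_sub_mem (r := toComp μ) ?_
  have h5 := Submodule.sub_mem _ (Submodule.add_mem _ h4
    (Submodule.smul_mem _ ((solomonEpi F n x : n.Partition → F) μ) h3)) h1
  convert h5 using 1
  rw [Pi.mul_apply, sub_mul, smul_sub, smul_mul_assoc, mul_assoc, mul_smul]
  abel

/-- Solomon's epimorphism as a homomorphism to the algebra of functions on the partitions. -/
noncomputable def solomonHom (F : Type*) [Field F] (n : ℕ) :
    descentAlgebra F n →ₐ[F] (n.Partition → F) :=
  AlgHom.ofLinearMap ((youngSpan F n).subtype ∘ₗ solomonEpi F n) (solomonEpi_one F) solomonEpi_mul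

theorem solomonHom_apply {F : Type*} [Field F] (x : descentAlgebra F n) :
    solomonHom F n x = (solomonEpi F n x : n.Partition → F) :=
  rfl

theorem solomonHom_xiD (F : Type*) [Field F] (q : Composition n) :
    solomonHom F n (xiD F q) = youngChar F q :=
  solomonEpi_xiD F q

theorem isNilpotent_of_solomonHom_eq_zero {F : Type*} [Field F] {x : descentAlgebra F n}
    (hx : solomonHom F n x = 0) : IsNilpotent x := by
  have hstep : ∀ (k : ℕ) (z : descentAlgebra F n),
      z ∈ Submodule.span F (xiD F '' {s : Composition n | k ≤ s.length}) →
      z * x ∈ Submodule.span F (xiD F '' {s : Composition n | k + 1 ≤ s.length}) := by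
    intro k z hz
    induction hz using Submodule.span_induction with
    | mem z h =>
      obtain ⟨r, hr, rfl⟩ := h
      have h1 := xiD_mul F (μ := Nat.Partition.ofComposition n r) rfl x
      have h2 : (solomonEpi F n x : n.Partition → F) (Nat.Partition.ofComposition n r) = 0 :=
        by rw [← solomonHom_apply, hx, Pi.zero_apply]
      rw [h2, zero_smul, sub_zero] at h1
      refine Submodule.span_mono (Set.image_mono fun s hs => ?_) h1
      have hr' : k ≤ r.length := hr
      exact Nat.succ_le_of_lt (Nat.lt_of_le_of_lt hr' hs.2)
    | zero => simp
    | add z w _ _ h1 h2 =>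
      rw [add_mul]
      exact Submodule.add_mem _ h1 h2
    | smul a z _ h =>
      rw [smul_mul_assoc]
      exact Submodule.smul_mem _ a h
  have hpow : ∀ k : ℕ, x ^ k ∈ Submodule.span F (xiD F '' {s : Composition n | k ≤ s.length}) := by
    intro k
    induction k with
    | zero =>
      rw [mem_span_xiD_iff]
      exact fun s _ => Nat.zero_le _
    | succ k ih =>
      rw [pow_succ]
      exact hstep k _ ih
  have h := hpow (n + 1)
  refine ⟨n + 1, ?_⟩
  have hempty : {s : Composition n | n + 1 ≤ s.length} = ∅ := by
    ext s
    have := s.length_le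
    simp only [Set.mem_ofPred_eq, Set.mem_empty_iff_false, iff_false]
    omega
  rwa [hempty, Set.image_empty, Submodule.span_empty, Submodule.mem_bot] at h

/-! ### The Young matrix and the elements `f_λ` -/

theorem multFactorial_ne_zero {p : ℕ} [hp : Fact p.Prime] (F : Type*) [Field F] [CharP F p]
    (lam : RegPartition n p) : (multFactorial lam.1 : F) ≠ 0 := by
  rw [multFactorial, Nat.cast_prod, Finset.prod_ne_zero_iff]
  intro i hi h
  rw [CharP.cast_eq_zero_iff F p, hp.out.dvd_factorial] at h
  exact absurd (lam.2 i (Multiset.mem_toFinset.1 hi)) (not_lt.2 h)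

/-- A linear order on the partitions in which weak refinements are smaller. -/
abbrev IsRefinementOrder (ord : LinearOrder n.Partition) : Prop :=
  ∀ μ lam : n.Partition, WeakRefines (toComp μ) (toComp lam) → ord.le μ lam

theorem isUnit_youngMatrix (p : ℕ) [Fact p.Prime] (F : Type*) [Field F] [CharP F p]
    {ord : LinearOrder n.Partition} (hord : IsRefinementOrder ord) :
    IsUnit (youngMatrix p F n) := by
  let _ : LinearOrder (RegPartition n p) :=
    @LinearOrder.lift' _ _ ord Subtype.val Subtype.val_injective
  have h : (youngMatrix p F n).IsLowerTriangular := by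
    intro lam μ hlt
    by_contra h0
    have h1 : ord.le μ.1 lam.1 := hord _ _ (weakRefines_of_youngChar_ne_zero h0)
    exact absurd (OrderDual.toDual_lt_toDual.1 hlt) (not_lt.2 h1)
  rw [Matrix.isUnit_iff_isUnit_det, isUnit_iff_ne_zero]
  have hd : (youngMatrix p F n).det ≠ 0 := by
    convert (Matrix.det_of_isLowerTriangular _ h).trans_ne (Finset.prod_ne_zero_iff.2 ?_)
    intro lam _
    rw [youngMatrix, Matrix.of_apply, youngChar_self]
    exact multFactorial_ne_zero F lam
  exact hd

section YoungMatrix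

variable {p : ℕ} [Fact p.Prime] {F : Type*} [Field F] [CharP F p] {ord : LinearOrder n.Partition}

theorem sum_inv_mul_youngChar (hord : IsRefinementOrder ord) (lam ν : RegPartition n p) :
    ∑ μ : RegPartition n p, (youngMatrix p F n)⁻¹ lam μ * youngChar F (toComp μ.1) ν.1 =
      if lam = ν then 1 else 0 := by
  have h := Matrix.nonsing_inv_mul (youngMatrix p F n)
    ((Matrix.isUnit_iff_isUnit_det _).1 (isUnit_youngMatrix p F hord))
  have h1 := congrFun (congrFun h lam) ν
  rw [Matrix.mul_apply, Matrix.one_apply] at h1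
  exact h1

/-- The inverse of the Young matrix is triangular for weak refinement: at a `μ` that is maximal among
the counterexamples, the sum that expresses `Φ⁻¹ Φ = 1` has only one nonzero term. -/
theorem weakRefines_of_inv_ne_zero (hord : IsRefinementOrder ord) {lam μ : RegPartition n p}
    (h : (youngMatrix p F n)⁻¹ lam μ ≠ 0) : WeakRefines (toComp μ.1) (toComp lam.1) := by
  classical
  by_contra hμ
  obtain ⟨μ, hμ, hmax⟩ := @Finset.exists_max_image _ _ ord
    (Finset.univ.filter fun μ : RegPartition n p => (youngMatrix p F n)⁻¹ lam μ ≠ 0 ∧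
      ¬ WeakRefines (toComp μ.1) (toComp lam.1)) Subtype.val ⟨μ, by simp [h, hμ]⟩
  simp only [Finset.mem_filter, Finset.mem_univ, true_and] at hμ hmax
  have h1 := sum_inv_mul_youngChar (F := F) hord lam μ
  rw [if_neg fun he : lam = μ => hμ.2 (he ▸ weakRefines_refl _), Finset.sum_eq_single μ] at h1
  · rw [youngChar_self] at h1
    exact mul_ne_zero hμ.1 (multFactorial_ne_zero F μ) h1
  · intro κ _ hκ
    by_contra h0
    have h2 := weakRefines_of_youngChar_ne_zero (right_ne_zero_of_mul h0)
    refine hκ (Subtype.ext (ord.le_antisymm _ _ (hmax κ ⟨left_ne_zero_of_mul h0, fun h3 => ?_⟩)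
      (hord _ _ h2)))
    exact hμ.2 (h2.trans h3)
  · simp

theorem inv_youngMatrix_self (hord : IsRefinementOrder ord) (lam : RegPartition n p) :
    (youngMatrix p F n)⁻¹ lam lam = (multFactorial lam.1 : F)⁻¹ := by
  have h1 := sum_inv_mul_youngChar (F := F) hord lam lam
  rw [if_pos rfl, Finset.sum_eq_single lam, youngChar_self] at h1
  · exact eq_inv_of_mul_eq_one_left h1
  · intro κ _ hκ
    by_contra h0
    exact hκ (Subtype.ext (ord.le_antisymm _ _
      (hord _ _ (weakRefines_of_inv_ne_zero hord (left_ne_zero_of_mul h0)))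
      (hord _ _ (weakRefines_of_youngChar_ne_zero (right_ne_zero_of_mul h0)))))
  · simp

/-- The two-sided ideal spanned by the `Ξ^ξ` with `ξ ≺ q`, as a linear subspace; for the ideal
property see `mul_mem_properIdeal_left` and `mul_mem_properIdeal_right`. -/
noncomputable def properIdeal (F : Type*) [Field F] (q : Composition n) :
    Submodule F (descentAlgebra F n) :=
  Submodule.span F (xiD F '' {ξ | ProperWeakRefines ξ q})

theorem fElt_sub_mem (hord : IsRefinementOrder ord) (lam : RegPartition n p) :
    fElt p F lam - (multFactorial lam.1 : F)⁻¹ • xiD F (toComp lam.1) ∈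
      properIdeal F (toComp lam.1) := by
  classical
  rw [fElt, ← Finset.add_sum_erase _ _ (Finset.mem_univ lam), inv_youngMatrix_self hord,
    add_sub_cancel_left]
  refine Submodule.sum_mem _ fun μ hμ => ?_
  by_cases h : (youngMatrix p F n)⁻¹ lam μ = 0
  · rw [h, zero_smul]
    exact Submodule.zero_mem _
  · refine Submodule.smul_mem _ _ (Submodule.subset_span
      ⟨_, ⟨weakRefines_of_inv_ne_zero hord h, fun hp => ?_⟩, rfl⟩)
    refine (Finset.mem_erase.1 hμ).1 (Subtype.ext (Nat.Partition.ext ?_))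
    rw [← toComp_blocks, ← toComp_blocks]
    exact Quot.sound hp

theorem eq_of_youngChar_eq (hord : IsRefinementOrder ord) {lam μ : RegPartition n p}
    (h : ∀ q, youngChar F q lam.1 = youngChar F q μ.1) : lam = μ := by
  have h1 := sum_inv_mul_youngChar (F := F) hord lam lam
  simp only [h] at h1
  rw [sum_inv_mul_youngChar hord] at h1
  by_contra hne
  simp [hne] at h1

end YoungMatrix

/-- The `p`-regular partition in the `p`-equivalence class of a partition. -/
noncomputable def regularization (p : ℕ) [Fact p.Prime] (μ : n.Partition) : RegPartition n p :=
  (exists_regular_pEquiv p μ).choose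

theorem pEquiv_regularization (p : ℕ) [Fact p.Prime] (μ : n.Partition) :
    PEquiv p μ (regularization p μ).1 :=
  (exists_regular_pEquiv p μ).choose_spec

theorem solomonHom_regularization (p : ℕ) [Fact p.Prime] {F : Type*} [Field F] [CharP F p]
    (x : descentAlgebra F n) (μ : n.Partition) :
    solomonHom F n x (regularization p μ).1 = solomonHom F n x μ := by
  induction x using descentAlgebra_induction with
  | hx q => rw [solomonHom_xiD, youngChar_eq_of_pEquiv F (pEquiv_regularization p μ)]
  | h0 => simp
  | ha x y h1 h2 => simp only [map_add, Pi.add_apply, h1, h2]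
  | hs a x h => simp only [map_smul, Pi.smul_apply, h]

theorem xiD_eq_one (F : Type*) [Field F] {q : Composition n} (hq : q.length ≤ 1) :
    xiD F q = 1 := by
  have h0 : ∀ a b, q.index a = q.index b := fun a b =>
    Fin.ext (by have := (q.index a).2; have := (q.index b).2; omega)
  have h : (Finset.univ.filter fun σ : Perm (Fin n) => descents σ ⊆ partialSums q) = {1} := by
    ext σ
    simp only [Finset.mem_filter, Finset.mem_univ, true_and, Finset.mem_singleton]
    rw [descents_subset_partialSums_iff]
    constructor
    · exact fun h => (Equiv.Perm.monotone_iff σ).1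
        (StrictMono.monotone fun a b hab => h a b hab (h0 a b))
    · rintro rfl a b hab _
      exact hab
  apply Subtype.ext
  change xi F q = 1
  rw [xi, h, Finset.sum_singleton]
  rfl

theorem length_toComp_indiscrete (n : ℕ) :
    (toComp (Nat.Partition.indiscrete n)).length ≤ 1 := by
  rcases Nat.eq_zero_or_pos n with rfl | hn
  · exact (toComp (Nat.Partition.indiscrete 0)).length_le.trans zero_le_one
  · rw [← Composition.blocks_length, ← Multiset.coe_card, toComp_blocks,
      Nat.Partition.indiscrete_parts hn.ne', Multiset.card_singleton]

/-- The partition with at most one part, as a `p`-regular partition. -/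
def trivialPartition (p : ℕ) [hp : Fact p.Prime] (n : ℕ) : RegPartition n p :=
  ⟨Nat.Partition.indiscrete n, fun i _ => by
    have h := length_toComp_indiscrete n
    rw [← Composition.blocks_length, ← Multiset.coe_card, toComp_blocks] at h
    exact ((Multiset.count_le_card i _).trans h).trans_lt hp.out.one_lt⟩

section Idempotents

variable {p : ℕ} [Fact p.Prime] {F : Type*} [Field F] [CharP F p] {ord : LinearOrder n.Partition}

theorem regularization_eq_iff (hord : IsRefinementOrder ord) (lam : RegPartition n p)
    (μ : n.Partition) : regularization p μ = lam ↔ PEquiv p μ lam.1 := by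
  refine ⟨fun h => h ▸ pEquiv_regularization p μ, fun h => ?_⟩
  have : CharP (ZMod p) p := ZMod.charP p
  exact eq_of_youngChar_eq (F := ZMod p) hord fun q => by
    rw [← youngChar_eq_of_pEquiv _ h, youngChar_eq_of_pEquiv _ (pEquiv_regularization p μ)]

theorem regularization_self (hord : IsRefinementOrder ord) (lam : RegPartition n p) :
    regularization p lam.1 = lam := by
  have : CharP (ZMod p) p := ZMod.charP p
  exact eq_of_youngChar_eq (F := ZMod p) hord fun q =>
    (youngChar_eq_of_pEquiv _ (pEquiv_regularization p lam.1) q).symm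

theorem solomonHom_fElt (hord : IsRefinementOrder ord) (lam : RegPartition n p) (μ : n.Partition) :
    solomonHom F n (fElt p F lam) μ = if regularization p μ = lam then 1 else 0 := by
  rw [← solomonHom_regularization p, fElt, map_sum, Finset.sum_apply]
  simp only [map_smul, Pi.smul_apply, solomonHom_xiD, smul_eq_mul]
  rw [sum_inv_mul_youngChar hord]
  simp only [eq_comm]

theorem sum_fElt (hord : IsRefinementOrder ord) : ∑ lam : RegPartition n p, fElt p F lam = 1 := by
  have h1 : xiD F (toComp (trivialPartition p n).1) = 1 :=
    xiD_eq_one F (length_toComp_indiscrete n)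
  have h2 := Matrix.mul_nonsing_inv (youngMatrix p F n)
    ((Matrix.isUnit_iff_isUnit_det _).1 (isUnit_youngMatrix p F hord))
  have h3 : ∀ μ : RegPartition n p, ∑ lam, (youngMatrix p F n)⁻¹ lam μ =
      if trivialPartition p n = μ then 1 else 0 := fun μ => by
    rw [← Matrix.one_apply, ← h2, Matrix.mul_apply]
    refine Finset.sum_congr rfl fun lam _ => ?_
    rw [youngMatrix, Matrix.of_apply, ← solomonHom_xiD, h1, map_one, Pi.one_apply, one_mul]
  simp only [fElt]
  rw [Finset.sum_comm]
  simp only [← Finset.sum_smul, h3]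
  rw [Finset.sum_eq_single (trivialPartition p n)]
  · rw [if_pos rfl, one_smul, h1]
  · intro μ _ hμ
    rw [if_neg hμ.symm, zero_smul]
  · simp

end Idempotents

theorem charFn_apply {p : ℕ} [Fact p.Prime] (F : Type*) [Field F] {ord : LinearOrder n.Partition}
    (hord : IsRefinementOrder ord) (lam : RegPartition n p) (μ : n.Partition) :
    charFn p F lam.1 μ = if regularization p μ = lam then 1 else 0 := by
  classical
  simp only [charFn, Set.indicator_apply, regularization_eq_iff hord, Set.mem_ofPred_eq,
    Pi.one_apply]

/-! ### The idempotents `f'` -/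

section Ring

variable {A : Type*} [Ring A]

theorem powPInf_eq {p k j : ℕ} {a : A} (hp : 0 < p) (h : IsIdempotentElem (a ^ p ^ k))
    (hj : k ≤ j) : powPInf p a = a ^ p ^ j := by
  classical
  have h' : ∃ k, IsIdempotentElem (a ^ p ^ k) := ⟨k, h⟩
  rw [powPInf, dif_pos h']
  obtain ⟨d, rfl⟩ := Nat.exists_eq_add_of_le ((Nat.find_min' h' h).trans hj)
  rw [pow_add, pow_mul, (Nat.find_spec h').pow_eq (pow_pos hp d).ne']

theorem exists_pow_prime_pow_eq {p : ℕ} [hp : Fact p.Prime] [CharP A p] {a b : A}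
    (hc : Commute a b) (hn : IsNilpotent (a - b)) : ∃ k, ∀ j, k ≤ j → a ^ p ^ j = b ^ p ^ j := by
  obtain ⟨k, hk⟩ := hn
  refine ⟨k, fun j hj => ?_⟩
  have h : (a - b) ^ p ^ j = 0 :=
    pow_eq_zero_of_le (hj.trans (Nat.lt_pow_self hp.out.one_lt).le) hk
  rwa [sub_pow_char_pow_of_commute _ _ hc, sub_eq_zero] at h

/-- If `a` is idempotent modulo a nil ideal then `a ^ p ^ k` is idempotent for large `k`, since
`(a² - a) ^ p ^ k = a ^ (2 p ^ k) - a ^ p ^ k`. -/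
theorem exists_powPInf {p : ℕ} [hp : Fact p.Prime] [CharP A p] {a : A}
    (hn : IsNilpotent (a * a - a)) :
    ∃ k, ∀ j, k ≤ j → powPInf p a = a ^ p ^ j ∧ IsIdempotentElem (a ^ p ^ j) := by
  obtain ⟨k, hk⟩ := exists_pow_prime_pow_eq (p := p) ((Commute.refl a).mul_left (Commute.refl a)) hn
  have hi : ∀ j, k ≤ j → IsIdempotentElem (a ^ p ^ j) := fun j hj => by
    rw [IsIdempotentElem, ← (Commute.refl a).mul_pow, hk j hj]
  exact ⟨k, fun j hj => ⟨powPInf_eq hp.out.pos (hi k le_rfl) hj, hi j hj⟩⟩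

theorem mul_pow_eq_of_mul_eq {e a : A} (h : e * a = a) {m : ℕ} (hm : m ≠ 0) :
    e * a ^ m = a ^ m := by
  obtain ⟨m, rfl⟩ := Nat.exists_eq_succ_of_ne_zero hm
  rw [pow_succ', ← mul_assoc, h]

theorem pow_mul_eq_of_mul_eq {e a : A} (h : a * e = a) {m : ℕ} (hm : m ≠ 0) :
    a ^ m * e = a ^ m := by
  obtain ⟨m, rfl⟩ := Nat.exists_eq_succ_of_ne_zero hm
  rw [pow_succ, mul_assoc, h]

end Ring

section Rank

variable {p : ℕ} (ord : LinearOrder n.Partition)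

theorem rank_lt_rank {lam μ : RegPartition n p} (h : ord.lt lam.1 μ.1) :
    rank ord lam < rank ord μ := by
  classical
  rw [rank, rank, Nat.card_eq_fintype_card, Nat.card_eq_fintype_card, Fintype.card_subtype,
    Fintype.card_subtype]
  refine Finset.card_lt_card (Finset.ssubset_iff_subset_ne.2 ⟨fun κ hκ => ?_, fun he => ?_⟩)
  · simp only [Finset.mem_filter, Finset.mem_univ, true_and] at hκ ⊢
    exact @lt_trans _ ord.toPreorder _ _ _ hκ h
  · have h1 : lam ∈ Finset.univ.filter fun κ : RegPartition n p => ord.lt κ.1 μ.1 := by simpa using h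
    rw [← he, Finset.mem_filter] at h1
    exact @lt_irrefl _ ord.toPreorder _ h1.2

theorem rank_lt_card (lam : RegPartition n p) :
    rank ord lam < Fintype.card (RegPartition n p) := by
  classical
  rw [rank, Nat.card_eq_fintype_card]
  exact Fintype.card_subtype_lt (x := lam) (@lt_irrefl _ ord.toPreorder _)

theorem rank_injective : Function.Injective (rank ord : RegPartition n p → ℕ) := by
  intro lam μ h
  by_contra hne
  rcases @lt_or_gt_of_ne _ ord _ _ (fun h => hne (Subtype.ext h) : lam.1 ≠ μ.1) with h1 | h1
  · exact (rank_lt_rank ord h1).ne h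
  · exact (rank_lt_rank ord h1).ne' h

theorem exists_rank_eq {i : ℕ} (hi : i < Fintype.card (RegPartition n p)) :
    ∃ lam : RegPartition n p, rank ord lam = i := by
  have hb : Function.Bijective fun lam : RegPartition n p =>
      (⟨rank ord lam, rank_lt_card ord lam⟩ : Fin (Fintype.card (RegPartition n p))) :=
    (Fintype.bijective_iff_injective_and_card _).2
      ⟨fun _ _ h => rank_injective ord (Fin.ext_iff.1 h), by simp⟩
  obtain ⟨lam, h⟩ := hb.2 ⟨i, hi⟩
  exact ⟨lam, Fin.ext_iff.1 h⟩

theorem sum_rank_lt {M : Type*} [AddCommMonoid M] (g : ℕ → M) {i : ℕ}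
    (hi : i ≤ Fintype.card (RegPartition n p)) :
    ∑ lam : RegPartition n p with rank ord lam < i, g (rank ord lam) =
      ∑ j ∈ Finset.range i, g j := by
  refine Finset.sum_bij (fun lam _ => rank ord lam) ?_ (fun _ _ _ _ h => rank_injective ord h) ?_ ?_
  · intro lam h
    simpa using h
  · intro j hj
    have hj' := Finset.mem_range.1 hj
    obtain ⟨lam, rfl⟩ := exists_rank_eq ord (hj'.trans_le hi)
    exact ⟨lam, by simpa using hj', rfl⟩
  · exact fun _ _ => rfl

theorem sum_eElt_rank_lt {F : Type*} [Field F] {i : ℕ}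
    (hi : i ≤ Fintype.card (RegPartition n p)) :
    ∑ lam : RegPartition n p with rank ord lam < i, eElt p F ord lam = 1 - fPrime p F ord i := by
  simp only [eElt]
  rw [sum_rank_lt ord (fun j => fPrime p F ord j - fPrime p F ord (j + 1)) hi,
    Finset.sum_range_sub']
  rfl

end Rank

/-- The indicator function of the `p`-equivalence classes with label of rank at least `i`. -/
noncomputable def rankIndicator (p : ℕ) [Fact p.Prime] (F : Type*) [Field F]
    (ord : LinearOrder n.Partition) (i : ℕ) (μ : n.Partition) : F :=
  if i ≤ rank ord (regularization p μ) then 1 else 0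

theorem rankIndicator_mul_self {p : ℕ} [Fact p.Prime] {F : Type*} [Field F]
    {ord : LinearOrder n.Partition} (i : ℕ) :
    rankIndicator p F ord i * rankIndicator p F ord i = rankIndicator p F ord i := by
  funext μ
  simp only [rankIndicator, Pi.mul_apply]
  split_ifs <;> simp

theorem rankIndicator_succ_mul {p : ℕ} [Fact p.Prime] {F : Type*} [Field F]
    {ord : LinearOrder n.Partition} (i : ℕ) :
    rankIndicator p F ord i * rankIndicator p F ord (i + 1) = rankIndicator p F ord (i + 1) := by
  funext μ
  simp only [rankIndicator, Pi.mul_apply]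
  split_ifs
  · simp
  · simp
  · omega
  · simp

section Idempotents

variable {p : ℕ} [hp : Fact p.Prime] {F : Type*} [Field F] [hF : CharP F p]
  {ord : LinearOrder n.Partition}

theorem charP_descentAlgebra (p : ℕ) (F : Type*) [Field F] [CharP F p] (n : ℕ) :
    CharP (descentAlgebra F n) p :=
  charP_of_injective_algebraMap (algebraMap F (descentAlgebra F n)).injective p

theorem solomonHom_fGe (hord : IsRefinementOrder ord) (i : ℕ) :
    solomonHom F n (fGe p F ord i) = rankIndicator p F ord i := by
  classical
  funext μ
  rw [fGe, map_sum, Finset.sum_apply]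
  simp only [solomonHom_fElt hord, rankIndicator]
  rw [Finset.sum_ite_eq]
  simp

/-- The element whose powers define `f'_{i+1}` is idempotent modulo the kernel of Solomon's
epimorphism. -/
theorem exists_fPrime_succ (hord : IsRefinementOrder ord) {i : ℕ}
    (h : solomonHom F n (fPrime p F ord i) = rankIndicator p F ord i) :
    ∃ k, ∀ j, k ≤ j →
      fPrime p F ord (i + 1) = (fPrime p F ord i * fGe p F ord (i + 1) * fPrime p F ord i) ^ p ^ j ∧
      IsIdempotentElem
        ((fPrime p F ord i * fGe p F ord (i + 1) * fPrime p F ord i) ^ p ^ j) := by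
  have := charP_descentAlgebra p F n
  refine exists_powPInf (isNilpotent_of_solomonHom_eq_zero ?_)
  simp only [map_sub, map_mul, h, solomonHom_fGe hord]
  rw [rankIndicator_succ_mul, mul_comm _ (rankIndicator p F ord i), rankIndicator_succ_mul,
    rankIndicator_mul_self, sub_self]

theorem fPrime_spec (hord : IsRefinementOrder ord) (i : ℕ) :
    IsIdempotentElem (fPrime p F ord i) ∧
      solomonHom F n (fPrime p F ord i) = rankIndicator p F ord i := by
  induction i with
  | zero =>
    refine ⟨IsIdempotentElem.one, ?_⟩
    rw [fPrime, map_one]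
    funext μ
    simp [rankIndicator]
  | succ i ih =>
    obtain ⟨k, hk⟩ := exists_fPrime_succ hord ih.2
    rw [(hk k le_rfl).1]
    refine ⟨(hk k le_rfl).2, ?_⟩
    simp only [map_pow, map_mul, ih.2, solomonHom_fGe hord]
    rw [rankIndicator_succ_mul, mul_comm _ (rankIndicator p F ord i), rankIndicator_succ_mul]
    exact IsIdempotentElem.pow_eq (a := rankIndicator p F ord (i + 1)) (rankIndicator_mul_self _)
      (pow_pos hp.out.pos k).ne'

theorem isIdempotentElem_fPrime (hord : IsRefinementOrder ord) (i : ℕ) :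
    IsIdempotentElem (fPrime p F ord i) :=
  (fPrime_spec hord i).1

theorem solomonHom_fPrime (hord : IsRefinementOrder ord) (i : ℕ) :
    solomonHom F n (fPrime p F ord i) = rankIndicator p F ord i :=
  (fPrime_spec hord i).2

theorem fPrime_mul_of_le (hord : IsRefinementOrder ord) {i j : ℕ} (hij : i ≤ j) :
    fPrime p F ord i * fPrime p F ord j = fPrime p F ord j ∧
      fPrime p F ord j * fPrime p F ord i = fPrime p F ord j := by
  induction j, hij using Nat.le_induction with
  | base => exact ⟨isIdempotentElem_fPrime hord i, isIdempotentElem_fPrime hord i⟩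
  | succ j _ ih =>
    have hj : fPrime p F ord j * fPrime p F ord j = fPrime p F ord j :=
      isIdempotentElem_fPrime hord j
    obtain ⟨k, hk⟩ := exists_fPrime_succ (F := F) hord (solomonHom_fPrime hord j)
    have h0 := (pow_pos hp.out.pos k).ne'
    have h1 : fPrime p F ord j * fPrime p F ord (j + 1) = fPrime p F ord (j + 1) := by
      rw [(hk k le_rfl).1]
      exact mul_pow_eq_of_mul_eq (by rw [← mul_assoc, ← mul_assoc, hj]) h0
    have h2 : fPrime p F ord (j + 1) * fPrime p F ord j = fPrime p F ord (j + 1) := by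
      rw [(hk k le_rfl).1]
      exact pow_mul_eq_of_mul_eq (by rw [mul_assoc, hj]) h0
    exact ⟨by rw [← h1, ← mul_assoc, ih.1], by rw [← h2, mul_assoc, ih.2]⟩

theorem eq_zero_of_isIdempotentElem {x : descentAlgebra F n} (hx : IsIdempotentElem x)
    (h : solomonHom F n x = 0) : x = 0 := by
  obtain ⟨k, hk⟩ := isNilpotent_of_solomonHom_eq_zero h
  rw [← hx.pow_succ_eq k, pow_succ, hk, zero_mul]

theorem fPrime_card (hord : IsRefinementOrder ord) :
    fPrime p F ord (Fintype.card (RegPartition n p)) = 0 := by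
  refine eq_zero_of_isIdempotentElem (isIdempotentElem_fPrime hord _) ?_
  rw [solomonHom_fPrime hord]
  funext μ
  exact if_neg (not_le.2 (rank_lt_card ord _))

theorem sum_eElt (hord : IsRefinementOrder ord) :
    ∑ lam : RegPartition n p, eElt p F ord lam = 1 := by
  have h := sum_eElt_rank_lt (p := p) ord (F := F) le_rfl
  rwa [Finset.filter_true_of_mem fun lam _ => rank_lt_card ord lam, fPrime_card hord,
    sub_zero] at h

theorem eElt_mul_eElt_of_lt (hord : IsRefinementOrder ord) {lam μ : RegPartition n p}
    (h : rank ord lam < rank ord μ) :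
    eElt p F ord lam * eElt p F ord μ = 0 ∧ eElt p F ord μ * eElt p F ord lam = 0 := by
  have h1 := fPrime_mul_of_le (F := F) hord h.le
  have h2 := fPrime_mul_of_le (F := F) hord (h.le.trans (Nat.le_succ _))
  have h3 := fPrime_mul_of_le (F := F) hord (Nat.succ_le_of_lt h)
  have h4 := fPrime_mul_of_le (F := F) hord ((Nat.succ_le_of_lt h).trans (Nat.le_succ _))
  simp only [Nat.succ_eq_add_one] at h2 h3 h4
  simp only [eElt, sub_mul, mul_sub, h1, h2, h3, h4, sub_self, and_self]

theorem completeOrthogonalIdempotents_eElt (hord : IsRefinementOrder ord) :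
    CompleteOrthogonalIdempotents (eElt p F ord : RegPartition n p → descentAlgebra F n) where
  idem lam := by
    have h1 := fPrime_mul_of_le (F := F) hord (Nat.le_succ (rank ord lam))
    have h2 := (isIdempotentElem_fPrime (F := F) hord (rank ord lam)).eq
    have h3 := (isIdempotentElem_fPrime (F := F) hord (rank ord lam + 1)).eq
    simp only [Nat.succ_eq_add_one] at h1
    simp only [IsIdempotentElem, eElt, sub_mul, mul_sub, h1, h2, h3, sub_self, sub_zero]
  ortho lam μ hne := by
    rcases lt_or_gt_of_ne fun h => hne (rank_injective ord h) with h | h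
    · exact (eElt_mul_eElt_of_lt hord h).1
    · exact (eElt_mul_eElt_of_lt hord h).2
  complete := sum_eElt hord

theorem solomonHom_eElt (hord : IsRefinementOrder ord) (lam : RegPartition n p) :
    solomonHom F n (eElt p F ord lam) = charFn p F lam.1 := by
  funext μ
  rw [charFn_apply F hord, eElt, map_sub, solomonHom_fPrime hord, solomonHom_fPrime hord,
    Pi.sub_apply, rankIndicator, rankIndicator]
  by_cases h : regularization p μ = lam
  · rw [if_pos h, h, if_pos le_rfl, if_neg (by omega), sub_zero]
  · have h1 := (rank_injective ord).ne h
    rw [if_neg h]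
    split_ifs <;> first | omega | simp

/-- An idempotent of the descent algebra that lies over a characteristic function of a
`p`-equivalence class is primitive, since the kernel of Solomon's epimorphism is nil and the
functions in its image are constant on `p`-equivalence classes. -/
theorem isPrimitiveIdempotent_of_charFn (hord : IsRefinementOrder ord) {e : descentAlgebra F n}
    (he : IsIdempotentElem e) {lam : RegPartition n p}
    (h : solomonHom F n e = charFn p F lam.1) : IsPrimitiveIdempotent e := by
  have hlam : charFn p F lam.1 lam.1 = 1 := by
    rw [charFn_apply F hord, if_pos (regularization_self hord lam)]
  refine ⟨he, fun h0 => ?_, fun a b ha hb hab hba hsum => ?_⟩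
  · rw [← h, h0, map_zero, Pi.zero_apply] at hlam
    exact zero_ne_one hlam
  have key : ∀ x : descentAlgebra F n, IsIdempotentElem x → e * x = x →
      solomonHom F n x lam.1 = 0 → x = 0 := by
    intro x hx hex hx0
    refine eq_zero_of_isIdempotentElem hx (funext fun μ => ?_)
    rw [← hex, map_mul, h, Pi.mul_apply, charFn_apply F hord]
    split_ifs with hμ
    · rw [← solomonHom_regularization p, hμ, hx0, mul_zero, Pi.zero_apply]
    · rw [zero_mul, Pi.zero_apply]
  have h1 : solomonHom F n a lam.1 * solomonHom F n b lam.1 = 0 := by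
    rw [← Pi.mul_apply, ← map_mul, hab, map_zero, Pi.zero_apply]
  rcases mul_eq_zero.1 h1 with h2 | h2
  · exact Or.inl (key a ha (by rw [hsum, add_mul, ha.eq, hba, add_zero]) h2)
  · exact Or.inr (key b hb (by rw [hsum, add_mul, hb.eq, hab, zero_add]) h2)

end Idempotents

/-! ### The leading terms of the idempotents -/

/-- The two-sided ideal spanned by the `Ξ^ξ` with `ξ ≼ q`, as a linear subspace. -/
noncomputable def refinementIdeal (F : Type*) [Field F] (q : Composition n) :
    Submodule F (descentAlgebra F n) :=
  Submodule.span F (xiD F '' {ξ | WeakRefines ξ q})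

theorem properIdeal_le {F : Type*} [Field F] {q : Composition n} :
    properIdeal F q ≤ refinementIdeal F q :=
  Submodule.span_mono (Set.image_mono fun _ h => h.1)

theorem mul_mem_properIdeal_right {F : Type*} [Field F] {q : Composition n}
    {x : descentAlgebra F n} (hx : x ∈ properIdeal F q) (y : descentAlgebra F n) :
    x * y ∈ properIdeal F q :=
  span_mul_mem (fun _ hr _ hs => ProperWeakRefines.of_weakRefines hs hr) hx y

theorem mul_mem_properIdeal_left {F : Type*} [Field F] {q : Composition n}
    {x : descentAlgebra F n} (hx : x ∈ properIdeal F q) (y : descentAlgebra F n) :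
    y * x ∈ properIdeal F q :=
  mul_span_mem (fun _ hr _ hs => ProperWeakRefines.of_weakRefines hs hr) hx y

/-- If `q` is not a weak refinement of `r` then an element that involves only weak refinements of
`q` and only weak refinements of `r` involves only proper weak refinements of `q`. -/
theorem mem_properIdeal_of_mem {F : Type*} [Field F] {q r : Composition n}
    (h : ¬ WeakRefines q r) {x : descentAlgebra F n} (hq : x ∈ refinementIdeal F q)
    (hr : x ∈ refinementIdeal F r) : x ∈ properIdeal F q := by
  rw [refinementIdeal, mem_span_xiD_iff] at hq hr
  rw [properIdeal, mem_span_xiD_iff]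
  exact fun ξ hξ => ⟨hq hξ, fun hp => h (WeakRefines.of_perm (hr hξ) hp.symm)⟩

theorem mul_mem_properIdeal {F : Type*} [Field F] {q r : Composition n}
    (h : ¬ WeakRefines q r) {x y : descentAlgebra F n} (hx : x ∈ refinementIdeal F r)
    (hy : y ∈ refinementIdeal F q) : x * y ∈ properIdeal F q :=
  mem_properIdeal_of_mem h (mul_span_mem (fun _ hr _ hs => WeakRefines.trans hs hr) hy x)
    (span_mul_mem (fun _ hr _ hs => WeakRefines.trans hs hr) hx y)

/-- Modulo the span of the `Ξ^ξ` with `ξ ≺ q`, right multiplication by `x` acts on `Ξ^q` as a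
scalar. -/
theorem xiD_mul_sub_mem_properIdeal (F : Type*) [Field F] (μ : n.Partition)
    (x : descentAlgebra F n) :
    xiD F (toComp μ) * x - solomonHom F n x μ • xiD F (toComp μ) ∈ properIdeal F (toComp μ) :=
  Submodule.span_mono (Set.image_mono fun _ hs => properWeakRefines_iff.2 hs)
    (xiD_mul F (toComp_blocks μ).symm x)

/-- The ideal `properIdeal F q` is the kernel of a homomorphism of rings. -/
theorem exists_ringHom_properIdeal.{u} {F : Type u} [Field F] (q : Composition n) :
    ∃ (Q : Type u) (_ : Ring Q) (π : descentAlgebra F n →+* Q),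
      ∀ x y, π x = π y ↔ x - y ∈ properIdeal F q := by
  let I : TwoSidedIdeal (descentAlgebra F n) := TwoSidedIdeal.mk' (properIdeal F q)
    (Submodule.zero_mem _) (Submodule.add_mem _) (Submodule.neg_mem _)
    (fun {x _} h => mul_mem_properIdeal_left h x) (fun {_ y} h => mul_mem_properIdeal_right h y)
  refine ⟨I.ringCon.Quotient, inferInstance, I.ringCon.mk', fun x y => ?_⟩
  refine (RingCon.eq I.ringCon).trans ((TwoSidedIdeal.rel_iff I x y).trans ?_)
  exact TwoSidedIdeal.mem_mk' _ _ _ _ _ _ _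

theorem sub_pow_succ_eq {A : Type*} [Ring A] {a f : A} (h1 : a * f = f) (h2 : f * a = f)
    (h3 : f * f = f) (m : ℕ) : (a - f) ^ (m + 1) = a ^ (m + 1) - f := by
  induction m with
  | zero => simp
  | succ m ih =>
    have h5 : ∀ k, a ^ k * f = f := fun k => by
      induction k with
      | zero => simp
      | succ k ih => rw [pow_succ, mul_assoc, h1, ih]
    rw [pow_succ, ih, sub_mul, mul_sub, mul_sub, h5, h2, h3, ← pow_succ]
    abel

theorem not_weakRefines_of_rank_lt {p : ℕ} {ord : LinearOrder n.Partition}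
    (hord : IsRefinementOrder ord) {lam μ : RegPartition n p}
    (h : rank ord μ < rank ord lam) : ¬ WeakRefines (toComp lam.1) (toComp μ.1) := by
  intro hr
  rcases @lt_or_eq_of_le _ ord.toPartialOrder _ _ (hord _ _ hr) with h1 | h1
  · exact absurd (rank_lt_rank ord h1) h.not_gt
  · rw [Subtype.ext h1] at h
    exact lt_irrefl _ h

theorem fGe_succ {p : ℕ} {F : Type*} [Field F] {ord : LinearOrder n.Partition}
    (lam : RegPartition n p) :
    fGe p F ord (rank ord lam + 1) = fGe p F ord (rank ord lam) - fElt p F lam := by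
  classical
  rw [eq_sub_iff_add_eq, fGe, fGe, add_comm]
  have h : (Finset.univ.filter fun μ : RegPartition n p => rank ord lam ≤ rank ord μ) =
      insert lam (Finset.univ.filter fun μ : RegPartition n p => rank ord lam + 1 ≤ rank ord μ) := by
    ext μ
    simp only [Finset.mem_filter, Finset.mem_univ, true_and, Finset.mem_insert]
    rw [← (rank_injective ord).eq_iff (a := μ)]
    omega
  rw [h, Finset.sum_insert (by simp)]

section Leading

variable {p : ℕ} [hp : Fact p.Prime] {F : Type*} [Field F] [hF : CharP F p]
  {ord : LinearOrder n.Partition}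

theorem fElt_mem (hord : IsRefinementOrder ord) (lam : RegPartition n p) :
    fElt p F lam ∈ refinementIdeal F (toComp lam.1) := by
  rw [← sub_add_cancel (fElt p F lam) _]
  exact Submodule.add_mem _ (properIdeal_le (fElt_sub_mem hord lam))
    (Submodule.smul_mem _ _ (Submodule.subset_span ⟨_, weakRefines_refl _, rfl⟩))

theorem fGe_eq (hord : IsRefinementOrder ord) (i : ℕ) :
    fGe p F ord i = 1 - ∑ lam : RegPartition n p with rank ord lam < i, fElt p F lam := by
  rw [eq_sub_iff_add_eq, ← sum_fElt hord, fGe, ← Finset.sum_filter_add_sum_filter_not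
    Finset.univ (fun lam : RegPartition n p => i ≤ rank ord lam)]
  simp only [not_le]

/-- The element `f'_i f_{≥ i} f'_i` commutes with `f'_i` and lies over the same function, so that its
large `p`-powers equal `f'_i`. -/
theorem exists_pow_eq_fPrime (hord : IsRefinementOrder ord) (i : ℕ) :
    ∃ k, ∀ j, k ≤ j →
      (fPrime p F ord i * fGe p F ord i * fPrime p F ord i) ^ p ^ j = fPrime p F ord i := by
  have := charP_descentAlgebra p F n
  have hi := isIdempotentElem_fPrime (F := F) hord i
  obtain ⟨k, hk⟩ := exists_pow_prime_pow_eq (p := p)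
    (a := fPrime p F ord i * fGe p F ord i * fPrime p F ord i) (b := fPrime p F ord i)
    (by rw [Commute, SemiconjBy, mul_assoc _ _ (fPrime p F ord i), hi.eq, ← mul_assoc, ← mul_assoc,
      hi.eq])
    (isNilpotent_of_solomonHom_eq_zero (by
      rw [map_sub, map_mul, map_mul, solomonHom_fPrime hord, solomonHom_fGe hord,
        rankIndicator_mul_self, rankIndicator_mul_self, sub_self]))
  exact ⟨k, fun j hj => (hk j hj).trans (hi.pow_eq (pow_pos hp.out.pos j).ne')⟩

/-- By induction on the rank `i` of `λ`. Let `φ` be the image of `Ξ^λ/λ¡` modulo the `Ξ^ξ` with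
`ξ ≺ λ`. By induction `f'_i` and `f_{≥ i}` differ from `1` by sums of elements that involve only
weak refinements of partitions `μ` of smaller rank, so that they fix `φ` from the left. Hence
`a = f'_i f_{≥ i} f'_i` fixes `φ` from both sides, and `a - φ` is the image of
`f'_i f_{≥ i + 1} f'_i`. Taking large `p`-powers gives `f'_{i + 1} ≡ f'_i - φ`. -/
theorem eElt_sub_mem (hord : IsRefinementOrder ord) (lam : RegPartition n p) :
    eElt p F ord lam - (multFactorial lam.1 : F)⁻¹ • xiD F (toComp lam.1) ∈
      properIdeal F (toComp lam.1) := by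
  classical
  induction hi : rank ord lam using Nat.strong_induction_on generalizing lam with
  | _ i ih =>
    subst hi
    obtain ⟨Q, _, π, hπ⟩ := exists_ringHom_properIdeal (F := F) (toComp lam.1)
    set f := (multFactorial lam.1 : F)⁻¹ • xiD F (toComp lam.1) with hf
    set g := fPrime p F ord (rank ord lam) with hg
    have hfmem : f ∈ refinementIdeal F (toComp lam.1) :=
      Submodule.smul_mem _ _ (Submodule.subset_span ⟨_, weakRefines_refl _, rfl⟩)
    -- Modulo the ideal, elements that involve only weak refinements of a partition of smaller rank
    -- annihilate `f` from the left.
    have hleft : ∀ h : RegPartition n p → descentAlgebra F n,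
        (∀ μ, rank ord μ < rank ord lam → h μ ∈ refinementIdeal F (toComp μ.1)) →
        π (1 - ∑ μ : RegPartition n p with rank ord μ < rank ord lam, h μ) * π f = π f := by
      intro h hh
      rw [← map_mul, hπ, sub_mul, one_mul, sub_sub_cancel_left, Finset.sum_mul]
      refine Submodule.neg_mem _ (Submodule.sum_mem _ fun μ hμ => ?_)
      have hlt := (Finset.mem_filter.1 hμ).2
      exact mul_mem_properIdeal (not_weakRefines_of_rank_lt hord hlt) (hh μ hlt) hfmem
    have hright : ∀ x, solomonHom F n x lam.1 = 1 → π f * π x = π f := by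
      intro x hx
      have h1 := xiD_mul_sub_mem_properIdeal F lam.1 x
      rw [hx, one_smul] at h1
      rw [← map_mul, hπ, hf, smul_mul_assoc, ← smul_sub]
      exact Submodule.smul_mem _ _ h1
    have hE : rankIndicator p F ord (rank ord lam) lam.1 = 1 := by
      rw [rankIndicator, regularization_self hord, if_pos le_rfl]
    have hgl : π g * π f = π f := by
      have h1 := sum_eElt_rank_lt ord (F := F) (rank_lt_card ord lam).le
      rw [hg, ← sub_sub_cancel 1 (fPrime p F ord (rank ord lam)), ← h1]
      refine hleft _ fun μ hμ => ?_
      have h2 := ih _ hμ μ rfl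
      rw [← sub_add_cancel (eElt p F ord μ) _]
      exact Submodule.add_mem _ (properIdeal_le h2)
        (Submodule.smul_mem _ _ (Submodule.subset_span ⟨_, weakRefines_refl _, rfl⟩))
    have hGl : π (fGe p F ord (rank ord lam)) * π f = π f := by
      rw [fGe_eq hord]
      exact hleft _ fun μ _ => fElt_mem hord μ
    have hgr : π f * π g = π f := hright _ (by rw [hg, solomonHom_fPrime hord, hE])
    have hGr : π f * π (fGe p F ord (rank ord lam)) = π f :=
      hright _ (by rw [solomonHom_fGe hord, hE])
    have hff : π f * π f = π f := hright _ (by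
      rw [hf, map_smul, Pi.smul_apply, solomonHom_xiD, youngChar_self, smul_eq_mul,
        inv_mul_cancel₀ (multFactorial_ne_zero F lam)])
    have hfE : π (fElt p F lam) = π f := (hπ _ _).2 (fElt_sub_mem hord lam)
    have hb : π (g * fGe p F ord (rank ord lam + 1) * g) =
        π (g * fGe p F ord (rank ord lam) * g) - π f := by
      rw [fGe_succ, mul_sub, sub_mul, map_sub]
      congr 1
      rw [map_mul, map_mul, hfE, hgl, hgr]
    obtain ⟨k, hk⟩ := exists_pow_eq_fPrime (F := F) hord (rank ord lam)
    obtain ⟨l, hl⟩ := exists_fPrime_succ (F := F) hord (solomonHom_fPrime hord (rank ord lam))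
    obtain ⟨m, hm⟩ := Nat.exists_eq_succ_of_ne_zero (pow_pos hp.out.pos (max k l)).ne'
    rw [← hπ, eElt, (hl (max k l) (le_max_right _ _)).1, map_sub, map_pow, ← hg, hb, hm,
      Nat.succ_eq_add_one, sub_pow_succ_eq, ← map_pow, ← Nat.succ_eq_add_one, ← hm,
      hk _ (le_max_left _ _), sub_sub_cancel]
    · rw [map_mul, map_mul, mul_assoc, hgl, mul_assoc, hGl, hgl]
    · rw [map_mul, map_mul, ← mul_assoc, ← mul_assoc, hgr, hGr, hgr]
    · exact hff

end Leading

end DescentAlg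

open DescentAlg
theorem theoremT (p : ℕ) [Fact p.Prime] (F : Type*) [Field F] [CharP F p] (n : ℕ)
    (ord : LinearOrder n.Partition)
    (hord : ∀ μ lam : n.Partition, WeakRefines (toComp μ) (toComp lam) → ord.le μ lam) :
    CompleteOrthogonalIdempotents (eElt p F ord : RegPartition n p → descentAlgebra F n) ∧
    (∀ lam : RegPartition n p, IsPrimitiveIdempotent (eElt p F ord lam)) ∧
    (∀ lam : RegPartition n p,
      (solomonEpi F n (eElt p F ord lam) : n.Partition → F) = charFn p F lam.1) ∧
    ∑ lam : RegPartition n p, eElt p F ord lam = 1 ∧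
    ∀ lam : RegPartition n p,
      ∃ ε ∈ Submodule.span F
          (xiD F '' {ξ : Composition n | ProperWeakRefines ξ (toComp lam.1)}),
        eElt p F ord lam = (multFactorial lam.1 : F)⁻¹ • xiD F (toComp lam.1) + ε := by
  have hc := completeOrthogonalIdempotents_eElt (p := p) (F := F) hord
  exact ⟨hc, fun lam => isPrimitiveIdempotent_of_charFn hord (hc.idem lam)
    (solomonHom_eElt hord lam), solomonHom_eElt hord, hc.complete,
    fun lam => ⟨_, eElt_sub_mem hord lam, (add_sub_cancel _ _).symm⟩⟩
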